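/- Let $v$ be a real planar formal vector field without parameters, written in the complex coordinate $z=y+ix$ as $$\dot z = F(z,\bar z)= iz+\sum_{j+k\ge 2}A_{jk}z^j\bar z^k,\qquad A_{jk}\in\mathbb C .$$ A near-identity state map is a formal change of variable $Z=\varphi(z,\bar z)=z+O(|z|^2)$; a near-identity time rescaling multiplies the vector field by a real formal series $T(z\bar z)=1+\sum_{k\ge1}T_k(z\bar z)^k$. In polar coordinates $z=\rho e^{i\theta}$, the vector field $\rho P(\rho^2)\partial_\rho+Q(\rho^2)\partial_\theta$ (with $P,Q$ real formal power series) is $\dot z=z\,(P(z\bar z)+iQ(z\bar z))$. Assume that $v$ is a (generalized) Hopf singularity, meaning that its amplitude equation is not formally trivial: no near-identity state map transforms $v$ into a field of the form $Q(\rho^2)\partial_\theta$. Then there exists a natural number $N_0\ge 1$ such that: 1. using near-identity state maps only, $v$ can be transformed into the simplest normal form $$\bigl(A_{N_0}\rho^{2N_0+1}+A_{2N_0}\rho^{4N_0+1}\bigr)\partial_\rho+\Bigl(1+\sum_{i=1}^{N_0}B_i\rho^{2i}\Bigr)\partial_\theta,\qquad A_{N_0}\neq0;$$ 2. using a near-identity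 state map followed by a near-identity time rescaling, $v$ can be transformed into the simplest orbital normal form $$\bigl(A_{N_0}\rho^{2N_0+1}+A_{2N_0}\rho^{4N_0+1}\bigr)\partial_\rho+\partial_\theta,\qquad A_{N_0}\neq0,$$ or alternatively into $$A_{N_0}\rho^{2N_0+1}\partial_\rho+\bigl(1+B_{N_0}\rho^{2N_0}\bigr)\partial_\theta,\qquad A_{N_0}\neq0 .$$ The coefficients are real and may differ from one form to another. Each of the three forms is simplest in the sense that it is unique: $N_0$ and all the coefficients of the form are uniquely determined by $v$, i.e. if $v$ is also transformed, by transformations of the same kind, into a form of the same shape with some $M\ge1$ in place of $N_0$ and other coefficients (the leading amplitude coefficient being nonzero), then $M=N_0$ and the coefficients coincide. -/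

import Mathlib

namespace HopfNF

/-- Complex formal power series `F(z, w)` in two variables (`z = X 0`, `w = X 1`). A real planar
formal vector field is written in the complex coordinate `z = y + i x` as
`dz/dt = F(z, z̄) = ∑ (α_{jk} + i β_{jk}) z^j z̄^k`, i.e. it is `∑ α_{jk} X_{jk} + ∑ β_{jk} Y_{jk}`
with real `α_{jk}, β_{jk}`. The conjugate variable `z̄` is represented by `w`. -/
abbrev Field2 : Type := MvPowerSeries (Fin 2) ℂ

/-- The complex conjugate `\overline{F(z, z̄)}`, again as a series in `z` and `w = z̄`: conjugate the
coefficients and exchange the two variables. -/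
noncomputable def conjSeries (F : Field2) : Field2 :=
  MvPowerSeries.renameEquiv ℂ (Equiv.swap (0 : Fin 2) 1) (MvPowerSeries.map (starRingEnd ℂ) F)

/-- `F` has zero constant term and linear part `c z`. -/
def HasLinearPart (c : ℂ) (F : Field2) : Prop :=
  MvPowerSeries.constantCoeff F = 0 ∧
  MvPowerSeries.coeff (Finsupp.single 0 1) F = c ∧
  MvPowerSeries.coeff (Finsupp.single 1 1) F = 0

/-- A near-identity (formal, real) state map `z ↦ φ(z, z̄) = z + O(|z|²)`. -/
def IsNearIdentity (φ : Field2) : Prop := HasLinearPart 1 φ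

/-- `G` is the push-forward `φ_* F`: if `ż = F(z, z̄)` and `Z = φ(z, z̄)` then `Ż = G(Z, Z̄)`, i.e.
`φ_z F + φ_{z̄} \overline{F} = G(φ, \overline{φ})`. -/
def IsPushforward (φ F G : Field2) : Prop :=
  MvPowerSeries.pderiv ℂ 0 φ * F + MvPowerSeries.pderiv ℂ 1 φ * conjSeries F =
    MvPowerSeries.subst ![φ, conjSeries φ] G

/-- `P(z z̄)` for a real formal power series `P` in one variable; `z z̄ = ρ²` in polar
coordinates `z = ρ e^{iθ}`. -/
noncomputable def radial (P : PowerSeries ℝ) : Field2 :=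
  PowerSeries.subst (MvPowerSeries.X 0 * MvPowerSeries.X 1 : Field2)
    (PowerSeries.map Complex.ofRealHom P)

/-- The vector field `ρ P(ρ²) ∂_ρ + Q(ρ²) ∂_θ` in polar coordinates `z = ρ e^{iθ}`, that is,
`ż = z (P(z z̄) + i Q(z z̄))`. -/
noncomputable def polarField (P Q : PowerSeries ℝ) : Field2 :=
  MvPowerSeries.X 0 * (radial P + MvPowerSeries.C Complex.I * radial Q)

/-- `F` is transformed into `G` by a near-identity state map. -/
def StateTransforms (F G : Field2) : Prop :=
  ∃ φ : Field2, IsNearIdentity φ ∧ IsPushforward φ F G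

/-- `F` is transformed into `G` by a near-identity state map followed by a near-identity time
rescaling, the latter being multiplication of the vector field by `T(z z̄) = 1 + ∑_{k ≥ 1} T_k (z z̄)^k`
with real coefficients. -/
def OrbitallyTransforms (F G : Field2) : Prop :=
  ∃ (T : PowerSeries ℝ) (H : Field2),
    PowerSeries.constantCoeff T = 1 ∧ StateTransforms F H ∧ G = radial T * H

/-- A nonparametric (generalized) Hopf singularity: `ż = i z + O(|z|²)`, and the amplitude
equation is not formally trivial, i.e. no near-identity state map brings the system to a
pure phase equation `Q(ρ²) ∂_θ`. -/
def IsGeneralizedHopf (F : Field2) : Prop :=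
  HasLinearPart Complex.I F ∧ ¬ ∃ Q : PowerSeries ℝ, StateTransforms F (polarField 0 Q)

/-- `(A ρ^{2N+1} + A' ρ^{4N+1}) ∂_ρ + (1 + ∑_{i=1}^N B_i ρ^{2i}) ∂_θ`. -/
noncomputable def stateForm (N : ℕ) (A A' : ℝ) (B : ℕ → ℝ) : Field2 :=
  polarField (PowerSeries.monomial N A + PowerSeries.monomial (2 * N) A')
    (1 + ∑ i ∈ Finset.Icc 1 N, PowerSeries.monomial i (B i))

/-- `(A ρ^{2N+1} + A' ρ^{4N+1}) ∂_ρ + ∂_θ`. -/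
noncomputable def orbitalForm₁ (N : ℕ) (A A' : ℝ) : Field2 :=
  polarField (PowerSeries.monomial N A + PowerSeries.monomial (2 * N) A') 1

/-- `A ρ^{2N+1} ∂_ρ + (1 + B ρ^{2N}) ∂_θ`. -/
noncomputable def orbitalForm₂ (N : ℕ) (A B : ℝ) : Field2 :=
  polarField (PowerSeries.monomial N A) (1 + PowerSeries.monomial N B)

end HopfNF

/-! Write `r = z z̄`. A state map `φ` carries `F` to `G` exactly when the derivation of `F` applied
to `φ` equals `G` composed with `(φ, φ̄)`. To leading order this equation acts on the coefficient of
`z^j z̄^k` in `φ` as multiplication by `i (j - k - 1)`, which vanishes only on the resonant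
monomials `z r^k`. Hence every field with linear part `i z` becomes `z U(r)`
(`exists_resonant_form`), and a near-identity map between two such fields must itself be `z W(r)`
(`IsPushforward.resonant`). Both existence and uniqueness are thereby questions about power series
in `r`.

For fields `z (P + iQ)` and `z (P' + iQ')` put `g = W W̄`. The conjugacy equation splits into an
amplitude part `(g + r g') P = g P'(r g)` and a phase part `Q + r P k = Q'(r g)`, with `k` coming
from the argument of `W`. Let `N` be the order of `P`, finite because the amplitude is not formally
trivial. In the amplitude equation the coefficient of `r^k` in `g` enters multiplied by a nonzero
multiple of `k - N`. Everything can thus be normalized except the leading term and the term where `k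
= N`, namely `r^(2N)` (`exists_amplitude_normalization`). Conversely those two terms are invariant
and `g = 1 + O(r^N)` (`amplitude_rigidity`). The phase can be changed by any multiple of `r P`, that
is, from `r^(N+1)` on (`stateTransforms_phase`), while its lower terms are fixed because `r g = r +
O(r^(N+1))`.

Under time rescaling only the ratio of amplitude to phase survives. Its residue at `r^(2N)` is
stored either in the amplitude or, through `1 / (1 + B r^N) = 1 - B r^N + ⋯`, in the phase; the
ambiguity `r P k` has too high an order to affect it. -/

namespace HopfNF

open MvPowerSeries Finsupp

/-! ### Total-degree filtration and fixed points of contracting maps -/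

section Filtration

variable {σ τ R : Type*} [CommRing R]

/-- The ideal of power series all of whose terms have total degree at least `n`. -/
def orderIdeal (n : ℕ) : Ideal (MvPowerSeries σ R) where
  carrier := {f | ∀ d : σ →₀ ℕ, d.degree < n → coeff d f = 0}
  add_mem' {f g} hf hg d hd := by rw [map_add, hf d hd, hg d hd, add_zero]
  zero_mem' d _ := by simp
  smul_mem' c f hf d hd := by
    classical
    rw [smul_eq_mul, coeff_mul]
    refine Finset.sum_eq_zero fun p hp => ?_
    rw [Finset.HasAntidiagonal.mem_antidiagonal] at hp
    rw [hf p.2, mul_zero]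
    rw [← hp, map_add] at hd
    omega

theorem mem_orderIdeal {n : ℕ} {f : MvPowerSeries σ R} :
    f ∈ orderIdeal n ↔ ∀ d : σ →₀ ℕ, d.degree < n → coeff d f = 0 := Iff.rfl

theorem orderIdeal_mono {m n : ℕ} (h : m ≤ n) {f : MvPowerSeries σ R} (hf : f ∈ orderIdeal n) :
    f ∈ orderIdeal m := fun d hd => hf d (hd.trans_le h)

theorem mem_orderIdeal_zero (f : MvPowerSeries σ R) : f ∈ orderIdeal 0 :=
  fun _ h => absurd h (Nat.not_lt_zero _)

theorem mem_orderIdeal_one {f : MvPowerSeries σ R} :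
    f ∈ orderIdeal 1 ↔ constantCoeff f = 0 := by
  rw [mem_orderIdeal, ← coeff_zero_eq_constantCoeff_apply]
  refine ⟨fun h => h 0 (by simp), fun h d hd => ?_⟩
  rw [Nat.lt_one_iff, degree_eq_zero_iff] at hd
  rw [hd, h]

theorem X_mem_orderIdeal_one (s : σ) : (X s : MvPowerSeries σ R) ∈ orderIdeal 1 :=
  mem_orderIdeal_one.2 (by simp)

theorem mul_mem_orderIdeal {m n : ℕ} {f g : MvPowerSeries σ R} (hf : f ∈ orderIdeal m)
    (hg : g ∈ orderIdeal n) : f * g ∈ orderIdeal (m + n) := by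
  classical
  intro d hd
  rw [coeff_mul]
  refine Finset.sum_eq_zero fun p hp => ?_
  rw [Finset.HasAntidiagonal.mem_antidiagonal] at hp
  rw [← hp, map_add] at hd
  rcases lt_or_ge p.1.degree m with h | h
  · rw [hf _ h, zero_mul]
  · rw [hg _ (by omega), mul_zero]

theorem pow_mem_orderIdeal {f : MvPowerSeries σ R} (hf : f ∈ orderIdeal 1) (n : ℕ) :
    f ^ n ∈ orderIdeal n := by
  induction n with
  | zero => exact mem_orderIdeal_zero _
  | succ n ih => rw [pow_succ]; exact mul_mem_orderIdeal ih hf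

theorem eq_zero_of_forall_mem_orderIdeal {f : MvPowerSeries σ R} (h : ∀ n, f ∈ orderIdeal n) :
    f = 0 := by
  ext d
  exact h (d.degree + 1) d (Nat.lt_succ_self _)

theorem eq_of_forall_sub_mem_orderIdeal {f g : MvPowerSeries σ R}
    (h : ∀ n, f - g ∈ orderIdeal n) : f = g :=
  sub_eq_zero.1 (eq_zero_of_forall_mem_orderIdeal h)

theorem pderiv_mem_orderIdeal {n : ℕ} {f : MvPowerSeries σ R} (hf : f ∈ orderIdeal n) (i : σ) :
    pderiv R i f ∈ orderIdeal (n - 1) := by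
  intro d hd
  rw [coeff_pderiv, hf, zero_mul]
  rw [map_add, degree_single]
  omega

/-- A map of the ring of power series to itself which raises the degree of agreement of any two
series has a fixed point. -/
theorem exists_fixedPoint_of_contracting (Ψ : MvPowerSeries σ R → MvPowerSeries σ R)
    (h : ∀ n x y, x - y ∈ orderIdeal n → Ψ x - Ψ y ∈ orderIdeal (n + 1)) : ∃ x, Ψ x = x := by
  have step : ∀ n, Ψ^[n + 1] 0 - Ψ^[n] 0 ∈ orderIdeal n := by
    intro n
    induction n with
    | zero => exact mem_orderIdeal_zero _
    | succ n ih =>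
      rw [Function.iterate_succ_apply' Ψ (n + 1), Function.iterate_succ_apply' Ψ n]
      rw [Function.iterate_succ_apply'] at ih
      exact h _ _ _ ih
  have steps : ∀ m n, Ψ^[n + m] 0 - Ψ^[n] 0 ∈ orderIdeal n := by
    intro m n
    induction m with
    | zero => simp
    | succ m ih =>
      rw [← sub_add_sub_cancel _ (Ψ^[n + m] 0)]
      exact add_mem (orderIdeal_mono (Nat.le_add_right _ _) (step (n + m))) ih
  -- The limit of the iterates: the coefficient at `d` no longer changes from iterate `d.degree + 1`
  -- on.
  let x : MvPowerSeries σ R := fun d => coeff d (Ψ^[d.degree + 1] 0)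
  have hx : ∀ n, x - Ψ^[n] 0 ∈ orderIdeal n := by
    intro n d hd
    obtain ⟨m, rfl⟩ := Nat.exists_eq_add_of_le (Nat.succ_le_of_lt hd)
    have := steps m (d.degree + 1) d (Nat.lt_succ_self _)
    rw [map_sub, sub_eq_zero] at this
    rw [map_sub, sub_eq_zero]
    exact this.symm
  refine ⟨x, eq_of_forall_sub_mem_orderIdeal fun n => ?_⟩
  have h1 := h n _ _ (hx n)
  rw [← Function.iterate_succ_apply' Ψ n] at h1
  have := sub_mem h1 (hx (n + 1))
  rw [sub_sub_sub_cancel_right] at this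
  exact orderIdeal_mono n.le_succ this

end Filtration

/-! ### Degree estimates and chain rule for substitution -/

section Substitution

variable {σ τ R : Type*} [CommRing R]

theorem hasSubst_of_mem_orderIdeal [Finite σ] {a : σ → MvPowerSeries τ R} (ha : ∀ i, a i ∈ orderIdeal 1) :
    MvPowerSeries.HasSubst a :=
  hasSubst_of_constantCoeff_zero fun i => mem_orderIdeal_one.1 (ha i)

theorem pow_sub_pow_mem_orderIdeal {a b : MvPowerSeries τ R} {n : ℕ} (ha : a ∈ orderIdeal 1)
    (hb : b ∈ orderIdeal 1) (h : a - b ∈ orderIdeal n) (k : ℕ) :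
    a ^ k - b ^ k ∈ orderIdeal (n + k - 1) := by
  induction k with
  | zero => simp
  | succ k ih =>
    have : a ^ (k + 1) - b ^ (k + 1) = a ^ k * (a - b) + (a ^ k - b ^ k) * b := by ring
    rw [this]
    refine add_mem (orderIdeal_mono ?_ (mul_mem_orderIdeal (pow_mem_orderIdeal ha k) h))
      (orderIdeal_mono ?_ (mul_mem_orderIdeal ih hb)) <;> omega

theorem prod_pow_mem_orderIdeal {a : σ → MvPowerSeries τ R} (ha : ∀ i, a i ∈ orderIdeal 1)
    (d : σ →₀ ℕ) : (d.prod fun s k => a s ^ k) ∈ orderIdeal d.degree := by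
  classical
  rw [Finsupp.prod, Finsupp.degree_apply]
  induction d.support using Finset.induction_on with
  | empty => exact mem_orderIdeal_zero _
  | insert i s hi ih =>
    rw [Finset.prod_insert hi, Finset.sum_insert hi]
    exact mul_mem_orderIdeal (pow_mem_orderIdeal (ha i) _) ih

/-- Telescoping replaces one factor at a time: that factor contributes `n`, the remaining `d.degree
- 1` factors contribute one each. -/
theorem prod_pow_sub_prod_pow_mem_orderIdeal {a b : σ → MvPowerSeries τ R} {n : ℕ}
    (ha : ∀ i, a i ∈ orderIdeal 1) (hb : ∀ i, b i ∈ orderIdeal 1)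
    (h : ∀ i, a i - b i ∈ orderIdeal n) (d : σ →₀ ℕ) :
    (d.prod fun s k => a s ^ k) - (d.prod fun s k => b s ^ k) ∈
      orderIdeal (n + d.degree - 1) := by
  classical
  rw [Finsupp.prod, Finsupp.prod, Finsupp.degree_apply]
  suffices H : ∀ s : Finset σ, (∏ i ∈ s, b i ^ d i) ∈ orderIdeal (∑ i ∈ s, d i) ∧
      (∏ i ∈ s, a i ^ d i) - ∏ i ∈ s, b i ^ d i ∈ orderIdeal (n + ∑ i ∈ s, d i - 1) from
    (H _).2
  intro s
  induction s using Finset.induction_on with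
  | empty => exact ⟨mem_orderIdeal_zero _, by simp⟩
  | insert i s hi ih =>
    rw [Finset.prod_insert hi, Finset.prod_insert hi, Finset.sum_insert hi]
    refine ⟨mul_mem_orderIdeal (pow_mem_orderIdeal (hb i) _) ih.1, ?_⟩
    rw [show a i ^ d i * ∏ i ∈ s, a i ^ d i - b i ^ d i * ∏ i ∈ s, b i ^ d i =
      a i ^ d i * (∏ i ∈ s, a i ^ d i - ∏ i ∈ s, b i ^ d i) +
        (a i ^ d i - b i ^ d i) * ∏ i ∈ s, b i ^ d i by ring]
    refine add_mem
      (orderIdeal_mono ?_ (mul_mem_orderIdeal (pow_mem_orderIdeal (ha i) _) ih.2))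
      (orderIdeal_mono ?_ (mul_mem_orderIdeal
        (pow_sub_pow_mem_orderIdeal (ha i) (hb i) (h i) (d i)) ih.1)) <;> omega

theorem subst_mem_orderIdeal [Finite σ] {a : σ → MvPowerSeries τ R} (ha : ∀ i, a i ∈ orderIdeal 1) {n : ℕ}
    {f : MvPowerSeries σ R} (hf : f ∈ orderIdeal n) :
    MvPowerSeries.subst a f ∈ orderIdeal n := by
  intro e he
  rw [MvPowerSeries.coeff_subst (hasSubst_of_mem_orderIdeal ha)]
  refine finsum_eq_zero_of_forall_eq_zero fun d => ?_
  rcases lt_or_ge d.degree n with h | h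
  · rw [hf d h, zero_smul]
  · rw [prod_pow_mem_orderIdeal ha d e (by omega), smul_zero]

theorem subst_sub_subst_mem_orderIdeal [Finite σ] {a b : σ → MvPowerSeries τ R} {n k : ℕ}
    (ha : ∀ i, a i ∈ orderIdeal 1) (hb : ∀ i, b i ∈ orderIdeal 1)
    (h : ∀ i, a i - b i ∈ orderIdeal n) {f : MvPowerSeries σ R} (hf : f ∈ orderIdeal k) :
    MvPowerSeries.subst a f - MvPowerSeries.subst b f ∈ orderIdeal (n + k - 1) := by
  intro e he
  rw [map_sub, MvPowerSeries.coeff_subst (hasSubst_of_mem_orderIdeal ha),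
    MvPowerSeries.coeff_subst (hasSubst_of_mem_orderIdeal hb), sub_eq_zero]
  refine finsum_congr fun d => ?_
  rcases lt_or_ge d.degree k with h' | h'
  · rw [hf d h', zero_smul, zero_smul]
  · have := prod_pow_sub_prod_pow_mem_orderIdeal ha hb h d e (by omega)
    rw [map_sub, sub_eq_zero] at this
    rw [this]

theorem pderiv_aeval [Fintype σ] (a : σ → MvPowerSeries τ R) (i : τ) (p : MvPolynomial σ R) :
    pderiv R i (MvPolynomial.aeval a p) =
      ∑ j, MvPolynomial.aeval a (MvPolynomial.pderiv j p) * pderiv R i (a j) := by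
  classical
  induction p using MvPolynomial.induction_on with
  | C r => simp
  | add p q hp hq => simp only [map_add, hp, hq, add_mul, Finset.sum_add_distrib]
  | mul_X p s hp =>
    have key : ∀ j, MvPolynomial.aeval a (MvPolynomial.pderiv j (p * MvPolynomial.X s)) =
        MvPolynomial.aeval a (MvPolynomial.pderiv j p) * a s +
          (if s = j then MvPolynomial.aeval a p else 0) := by
      intro j
      rw [MvPolynomial.pderiv_mul, map_add, map_mul, map_mul, MvPolynomial.aeval_X,
        MvPolynomial.pderiv_X, Pi.single_apply]
      congr 1
      split_ifs <;> simp
    simp only [key]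
    simp only [map_mul, MvPolynomial.aeval_X, Derivation.leibniz, smul_eq_mul, hp, add_mul,
      Finset.sum_add_distrib, ite_mul, zero_mul, Finset.sum_ite_eq, Finset.mem_univ, if_true,
      Finset.mul_sum]
    rw [add_comm]
    congr 1
    exact Finset.sum_congr rfl fun j _ => by ring

/-- The chain rule for the substitution of power series without constant term. -/
theorem pderiv_subst [Fintype σ] {a : σ → MvPowerSeries τ R} (ha : ∀ i, a i ∈ orderIdeal 1)
    (i : τ) (f : MvPowerSeries σ R) :
    pderiv R i (MvPowerSeries.subst a f) =
      ∑ j, MvPowerSeries.subst a (pderiv R j f) * pderiv R i (a j) := by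
  have hs := hasSubst_of_mem_orderIdeal ha
  refine eq_of_forall_sub_mem_orderIdeal fun n => ?_
  -- The polynomial `p` obeys the chain rule by `pderiv_aeval`. The remainder has order `n + 1`,
  -- since differentiation costs one degree.
  set p := truncTotal (n + 1) f
  have hp : f - (p : MvPowerSeries σ R) ∈ orderIdeal (n + 1) := by
    intro d hd
    rw [map_sub, MvPolynomial.coeff_coe, coeff_truncTotal _ hd, sub_self]
  have h1 : pderiv R i (MvPowerSeries.subst a (p : MvPowerSeries σ R)) =
      ∑ j, MvPowerSeries.subst a (pderiv R j (p : MvPowerSeries σ R)) * pderiv R i (a j) := by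
    simp only [pderiv_coe, MvPowerSeries.subst_coe]
    exact pderiv_aeval a i p
  obtain ⟨g, hg⟩ : ∃ g, g = f - (p : MvPowerSeries σ R) := ⟨_, rfl⟩
  have hf : f = p + g := by rw [hg]; ring
  rw [← hg] at hp
  rw [hf]
  simp only [MvPowerSeries.subst_add hs, map_add, add_mul, Finset.sum_add_distrib]
  rw [h1, add_sub_add_left_eq_sub]
  refine sub_mem (pderiv_mem_orderIdeal (subst_mem_orderIdeal ha hp) i)
    (Ideal.sum_mem _ fun j _ => Ideal.mul_mem_right _ _
      (subst_mem_orderIdeal ha (pderiv_mem_orderIdeal hp j)))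

end Substitution

end HopfNF

namespace HopfNF

open MvPowerSeries Finsupp

/-! ### Complex conjugation of series in `z, z̄` -/

section Conjugation

/-- `conjSeries` as a ring homomorphism. -/
noncomputable def conjHom : Field2 →+* Field2 :=
  (renameEquiv ℂ (Equiv.swap (0 : Fin 2) 1) : Field2 →+* Field2).comp
    (MvPowerSeries.map (starRingEnd ℂ))

theorem conjHom_eq_rename (F : Field2) : conjHom F =
    rename (Equiv.swap (0 : Fin 2) 1) (MvPowerSeries.map (starRingEnd ℂ) F) := rfl

theorem coeff_conjHom (F : Field2) (e : Fin 2 →₀ ℕ) :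
    coeff e (conjHom F) = starRingEnd ℂ (coeff (e.mapDomain (Equiv.swap (0 : Fin 2) 1)) F) := by
  have h := coeff_embDomain_rename (Equiv.swap (0 : Fin 2) 1).toEmbedding
    (MvPowerSeries.map (starRingEnd ℂ) F) (e.mapDomain (Equiv.swap (0 : Fin 2) 1))
  rw [embDomain_eq_mapDomain, ← mapDomain_comp] at h
  have hid : ((Equiv.swap (0 : Fin 2) 1).toEmbedding : Fin 2 → Fin 2) ∘ (Equiv.swap (0 : Fin 2) 1) = id := by
    ext x; simp
  rw [hid, mapDomain_id, coeff_map] at h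
  exact h

theorem conjHom_conjHom (F : Field2) : conjHom (conjHom F) = F := by
  ext e
  rw [coeff_conjHom, coeff_conjHom, ← mapDomain_comp, Complex.conj_conj]
  congr 2
  have hid : (Equiv.swap (0 : Fin 2) 1 : Fin 2 → Fin 2) ∘ (Equiv.swap (0 : Fin 2) 1) = id := by
    ext x; simp
  rw [hid, mapDomain_id]

@[simp] theorem conjHom_X_zero : conjHom (X 0) = X 1 := by simp [conjHom_eq_rename]

@[simp] theorem conjHom_C (c : ℂ) : conjHom (C c) = C (starRingEnd ℂ c) := by
  simp [conjHom_eq_rename]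

theorem conjHom_mem_orderIdeal {F : Field2} {n : ℕ} (hF : F ∈ orderIdeal n) :
    conjHom F ∈ orderIdeal n := by
  intro e he
  rw [coeff_conjHom, hF _ (by rwa [degree_mapDomain]), map_zero]

theorem conjHom_pderiv_zero (F : Field2) :
    conjHom (pderiv ℂ 0 F) = pderiv ℂ 1 (conjHom F) := by
  ext e
  rw [coeff_conjHom, coeff_pderiv, coeff_pderiv, coeff_conjHom, mapDomain_add, mapDomain_single,
    Equiv.swap_apply_right, map_mul, map_add, map_one, map_natCast, mapDomain_equiv_apply]
  simp

theorem conjHom_pderiv_one (F : Field2) :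
    conjHom (pderiv ℂ 1 F) = pderiv ℂ 0 (conjHom F) := by
  rw [← conjHom_conjHom (pderiv ℂ 0 (conjHom F)), conjHom_pderiv_zero, conjHom_conjHom]

end Conjugation

/-! ### Near-identity state maps form a groupoid -/

section StateMaps

/-- The substitution family `(φ, φ̄)`. -/
noncomputable abbrev pair (φ : Field2) : Fin 2 → Field2 := ![φ, conjHom φ]

theorem pair_mem_orderIdeal {φ : Field2} {n : ℕ} (h : φ ∈ orderIdeal n) (i : Fin 2) :
    pair φ i ∈ orderIdeal n := by
  fin_cases i
  exacts [h, conjHom_mem_orderIdeal h]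

theorem pair_sub_mem_orderIdeal {φ ψ : Field2} {n : ℕ} (h : φ - ψ ∈ orderIdeal n) (i : Fin 2) :
    pair φ i - pair ψ i ∈ orderIdeal n := by
  fin_cases i
  · exact h
  · have := conjHom_mem_orderIdeal h
    rwa [map_sub] at this

theorem pair_X : pair (X 0) = X := by
  funext i
  fin_cases i <;> simp [pair]

theorem hasSubst_pair {φ : Field2} (h : φ ∈ orderIdeal 1) : MvPowerSeries.HasSubst (pair φ) :=
  hasSubst_of_mem_orderIdeal (pair_mem_orderIdeal h)

theorem conjHom_subst_pair {φ : Field2} (h : φ ∈ orderIdeal 1) (H : Field2) :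
    conjHom (MvPowerSeries.subst (pair φ) H) = MvPowerSeries.subst (pair φ) (conjHom H) := by
  have hs := hasSubst_pair h
  rw [conjHom_eq_rename, map_subst hs, rename_eq_subst,
    subst_comp_subst_apply (hs.map _) (HasSubst.X_comp _), conjHom_eq_rename, rename_eq_subst,
    subst_comp_subst_apply (HasSubst.X_comp _) hs]
  congr 1
  funext i
  rw [← rename_eq_subst, Function.comp_apply, MvPowerSeries.subst_X hs, ← conjHom_eq_rename]
  fin_cases i
  · simp [pair]
  · simp [pair, conjHom_conjHom]

theorem hasLinearPart_iff {c : ℂ} {F : Field2} :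
    HasLinearPart c F ↔ F - C c * X 0 ∈ orderIdeal 2 := by
  classical
  constructor
  · rintro ⟨h0, h1, h2⟩ e he
    rw [degree_eq_sum, Fin.sum_univ_two] at he
    have : e = 0 ∨ e = single 0 1 ∨ e = single 1 1 := by
      rcases Nat.lt_or_ge (e 0) 1 with h | h <;> rcases Nat.lt_or_ge (e 1) 1 with h' | h'
      · left; ext i; fin_cases i <;> simp <;> omega
      · right; right; ext i; fin_cases i <;> simp <;> omega
      · right; left; ext i; fin_cases i <;> simp <;> omega
      · omega
    rcases this with rfl | rfl | rfl
    · simp [h0]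
    · simp [h1, coeff_X]
    · simp [h2, coeff_X, single_left_inj]
  · intro h
    have h0 := h 0 (by simp)
    have h1 := h (single 0 1) (by simp)
    have h2 := h (single 1 1) (by simp)
    refine ⟨?_, ?_, ?_⟩
    · simpa using h0
    · simpa [coeff_X, sub_eq_zero] using h1
    · simpa [coeff_X, single_left_inj] using h2

theorem isNearIdentity_iff {φ : Field2} : IsNearIdentity φ ↔ φ - X 0 ∈ orderIdeal 2 := by
  rw [IsNearIdentity, hasLinearPart_iff, map_one, one_mul]

theorem IsNearIdentity.mem_orderIdeal_one {φ : Field2} (h : IsNearIdentity φ) :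
    φ ∈ orderIdeal 1 := HopfNF.mem_orderIdeal_one.2 h.1

theorem subst_pair_sub_mem_orderIdeal {φ : Field2} (h : IsNearIdentity φ) {n : ℕ} {H : Field2}
    (hH : H ∈ orderIdeal n) : MvPowerSeries.subst (pair φ) H - H ∈ orderIdeal (n + 1) := by
  have := subst_sub_subst_mem_orderIdeal (pair_mem_orderIdeal h.mem_orderIdeal_one)
    (pair_mem_orderIdeal (X_mem_orderIdeal_one 0))
    (pair_sub_mem_orderIdeal (isNearIdentity_iff.1 h)) hH
  rw [pair_X, subst_self, id] at this
  exact orderIdeal_mono (by omega) this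

theorem subst_pair_injective {φ : Field2} (h : IsNearIdentity φ) :
    Function.Injective (MvPowerSeries.subst (pair φ) : Field2 → Field2) := by
  intro H K hHK
  refine eq_of_forall_sub_mem_orderIdeal fun n => ?_
  induction n with
  | zero => exact mem_orderIdeal_zero _
  | succ n ih =>
    have := subst_pair_sub_mem_orderIdeal h ih
    rw [MvPowerSeries.subst_sub (hasSubst_pair h.mem_orderIdeal_one), hHK, sub_self,
      zero_sub] at this
    exact neg_mem_iff.1 this

/-- A near-identity substitution differs from the identity by an operator that raises degree, so `H
= K - (H ∘ φ - H)` has a solution by contraction. -/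
theorem subst_pair_surjective {φ : Field2} (h : IsNearIdentity φ) :
    Function.Surjective (MvPowerSeries.subst (pair φ) : Field2 → Field2) := by
  intro K
  obtain ⟨H, hH⟩ := exists_fixedPoint_of_contracting
    (fun H : Field2 => K - (MvPowerSeries.subst (pair φ) H - H)) fun n x y hxy => by
      have := subst_pair_sub_mem_orderIdeal h hxy
      rw [MvPowerSeries.subst_sub (hasSubst_pair h.mem_orderIdeal_one)] at this
      have h' := neg_mem this
      convert h' using 1
      ring
  refine ⟨H, ?_⟩
  have : K - (MvPowerSeries.subst (pair φ) H - H) = H := hH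
  linear_combination -this

/-- The derivation of the ring of power series in `z, z̄` defined by the vector field `F`. -/
noncomputable def fieldDeriv (F : Field2) : Derivation ℂ Field2 Field2 :=
  F • pderiv ℂ 0 + conjHom F • pderiv ℂ 1

theorem fieldDeriv_apply (F H : Field2) :
    fieldDeriv F H = F * pderiv ℂ 0 H + conjHom F * pderiv ℂ 1 H := rfl

theorem fieldDeriv_X_zero (F : Field2) : fieldDeriv F (X 0) = F := by
  rw [fieldDeriv_apply, pderiv_X_self, pderiv_X_of_ne (by decide), mul_one, mul_zero, add_zero]

theorem conjHom_fieldDeriv (F H : Field2) :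
    conjHom (fieldDeriv F H) = fieldDeriv F (conjHom H) := by
  rw [fieldDeriv_apply, fieldDeriv_apply, map_add, map_mul, map_mul, conjHom_pderiv_zero,
    conjHom_pderiv_one, conjHom_conjHom, add_comm]

theorem isPushforward_iff {φ F G : Field2} :
    IsPushforward φ F G ↔ fieldDeriv F φ = MvPowerSeries.subst (pair φ) G := by
  rw [fieldDeriv_apply, mul_comm F, mul_comm (conjHom F)]
  rfl

/-- The pushforward equation says this for the coordinate `z`; conjugation gives it for `z̄`, and
the chain rule for every series. Inversion and composition of state maps rest on it. -/
theorem IsPushforward.fieldDeriv_subst {φ F G : Field2} (hφ : φ ∈ orderIdeal 1)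
    (h : IsPushforward φ F G) (H : Field2) :
    fieldDeriv F (MvPowerSeries.subst (pair φ) H) =
      MvPowerSeries.subst (pair φ) (fieldDeriv G H) := by
  rw [isPushforward_iff] at h
  have h' : fieldDeriv F (conjHom φ) = MvPowerSeries.subst (pair φ) (conjHom G) := by
    rw [← conjHom_fieldDeriv, h, conjHom_subst_pair hφ]
  have hs := hasSubst_pair hφ
  rw [fieldDeriv_apply G, MvPowerSeries.subst_add hs, MvPowerSeries.subst_mul hs,
    MvPowerSeries.subst_mul hs, ← h, ← h']
  simp only [fieldDeriv_apply, pderiv_subst (pair_mem_orderIdeal hφ), Fin.sum_univ_two]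
  simp only [pair, Matrix.cons_val_zero, Matrix.cons_val_one]
  ring

theorem StateTransforms.symm {F G : Field2} (h : StateTransforms F G) : StateTransforms G F := by
  obtain ⟨φ, hφ, h⟩ := h
  have hφ1 := hφ.mem_orderIdeal_one
  have hs := hasSubst_pair hφ1
  -- `ψ` is the inverse of `φ`; its pushforward equation is checked after composing with `φ`, which
  -- is injective.
  obtain ⟨ψ, hψ⟩ := subst_pair_surjective hφ (X 0)
  have key : ∀ n, ψ ∈ orderIdeal n → X 0 - ψ ∈ orderIdeal (n + 1) := fun n hn => by
    have := subst_pair_sub_mem_orderIdeal hφ hn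
    rwa [hψ] at this
  have hψ1 : ψ ∈ orderIdeal 1 := by
    have := sub_mem (X_mem_orderIdeal_one 0) (key 0 (mem_orderIdeal_zero _))
    rwa [sub_sub_cancel] at this
  have hψn : IsNearIdentity ψ := by
    rw [isNearIdentity_iff, ← neg_sub]
    exact neg_mem (key 1 hψ1)
  refine ⟨ψ, hψn, isPushforward_iff.2 (subst_pair_injective hφ ?_)⟩
  rw [← h.fieldDeriv_subst hφ1, hψ, fieldDeriv_X_zero,
    subst_comp_subst_apply (hasSubst_pair hψ1) hs]
  have : (fun s => MvPowerSeries.subst (pair φ) (pair ψ s)) = X := by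
    rw [← pair_X]
    funext i
    fin_cases i
    · exact hψ
    · simp [pair, ← conjHom_subst_pair hφ1, hψ]
  rw [this, subst_self, id]

theorem StateTransforms.trans {F G H : Field2} (h : StateTransforms F G)
    (h' : StateTransforms G H) : StateTransforms F H := by
  obtain ⟨φ, hφ, h⟩ := h
  obtain ⟨ψ, hψ, h'⟩ := h'
  have hφ1 := hφ.mem_orderIdeal_one
  have hψ1 := hψ.mem_orderIdeal_one
  refine ⟨MvPowerSeries.subst (pair φ) ψ, ?_, ?_⟩
  · rw [isNearIdentity_iff] at hψ ⊢
    have := add_mem (subst_pair_sub_mem_orderIdeal hφ hψ1) hψ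
    rwa [sub_add_sub_cancel] at this
  · rw [isPushforward_iff] at h' ⊢
    rw [h.fieldDeriv_subst hφ1, h', subst_comp_subst_apply (hasSubst_pair hψ1) (hasSubst_pair hφ1)]
    congr 1
    funext i
    fin_cases i
    · rfl
    · simp [pair, conjHom_subst_pair hφ1]

end StateMaps

end HopfNF

namespace HopfNF

open MvPowerSeries Finsupp

/-! ### Resonant fields `z U(z z̄)` and reduction to one variable -/

section Radial

theorem X_mul_X_mem_orderIdeal : (X 0 * X 1 : Field2) ∈ orderIdeal 1 :=
  Ideal.mul_mem_right _ _ (X_mem_orderIdeal_one 0)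

theorem hasSubst_X_mul_X : PowerSeries.HasSubst (X 0 * X 1 : Field2) :=
  PowerSeries.HasSubst.of_constantCoeff_zero (by simp)

/-- The series `U(z z̄)` for a complex power series `U` in one variable. -/
noncomputable def rad : PowerSeries ℂ →ₐ[ℂ] Field2 := PowerSeries.substAlgHom hasSubst_X_mul_X

theorem rad_apply (U : PowerSeries ℂ) : rad U = PowerSeries.subst (X 0 * X 1 : Field2) U := by
  rw [rad, PowerSeries.coe_substAlgHom]

theorem radial_eq_rad (P : PowerSeries ℝ) :
    radial P = rad (PowerSeries.map Complex.ofRealHom P) := (rad_apply _).symm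

theorem rad_X : rad PowerSeries.X = X 0 * X 1 := by
  rw [rad, PowerSeries.substAlgHom_X]

theorem rad_C (c : ℂ) : rad (PowerSeries.C c) = C c := by
  rw [rad_apply, PowerSeries.subst_C]

theorem coeff_rad (U : PowerSeries ℂ) (e : Fin 2 →₀ ℕ) :
    coeff e (rad U) = if e 0 = e 1 then PowerSeries.coeff (e 0) U else 0 := by
  classical
  have hpow : ∀ d : ℕ, (X 0 * X 1 : Field2) ^ d = monomial (single 0 d + single 1 d) 1 := by
    intro d
    rw [mul_pow, X_pow_eq, X_pow_eq, monomial_mul_monomial, one_mul]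
  have hiff : ∀ d : ℕ, e = single 0 d + single 1 d ↔ e 0 = d ∧ e 1 = d := by
    intro d
    rw [Finsupp.ext_iff, Fin.forall_fin_two]
    simp
  rw [rad_apply, PowerSeries.coeff_subst hasSubst_X_mul_X, finsum_eq_single _ (e 0)]
  · rw [hpow, coeff_monomial]
    simp only [hiff, true_and, eq_comm (a := e 1)]
    split_ifs <;> simp
  · intro d hd
    rw [hpow, coeff_monomial, if_neg, smul_zero]
    rw [hiff]
    exact fun h => hd h.1.symm

theorem coeff_X_zero_mul_rad (U : PowerSeries ℂ) (e : Fin 2 →₀ ℕ) :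
    coeff e (X 0 * rad U) = if e 0 = e 1 + 1 then PowerSeries.coeff (e 1) U else 0 := by
  classical
  rw [X, coeff_monomial_mul]
  by_cases h : single (0 : Fin 2) 1 ≤ e
  · have h1 : 1 ≤ e 0 := by simpa using h 0
    rw [if_pos h, one_mul, coeff_rad]
    have h2 : (e - single 0 1 : Fin 2 →₀ ℕ) 0 = e 0 - 1 := by simp
    have h3 : (e - single 0 1 : Fin 2 →₀ ℕ) 1 = e 1 := by simp
    rw [h2, h3]
    by_cases h4 : e 0 = e 1 + 1
    · rw [if_pos h4, if_pos (by omega), h4, Nat.add_sub_cancel]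
    · rw [if_neg h4, if_neg (by omega)]
  · rw [if_neg h, if_neg]
    intro h4
    refine h (Finsupp.single_le_iff.2 ?_)
    omega

theorem X_zero_mul_rad_injective : Function.Injective fun U => X 0 * rad U := by
  intro U V h
  ext n
  have := congrArg (coeff (single (0 : Fin 2) (n + 1) + single 1 n)) h
  simpa [coeff_X_zero_mul_rad] using this

/-- A series all of whose terms are resonant, i.e. of the form `c z (z z̄)^n`, is `z U(z z̄)`. -/
theorem exists_eq_X_zero_mul_rad {F : Field2}
    (hF : ∀ e : Fin 2 →₀ ℕ, e 0 ≠ e 1 + 1 → coeff e F = 0) :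
    ∃ U : PowerSeries ℂ, F = X 0 * rad U := by
  refine ⟨PowerSeries.mk fun n => coeff (single (0 : Fin 2) (n + 1) + single 1 n) F, ?_⟩
  ext e
  rw [coeff_X_zero_mul_rad]
  split_ifs with h
  · rw [PowerSeries.coeff_mk]
    congr 2
    ext i
    fin_cases i <;> simp [h]
  · exact hF e h

/-- Conjugation of the coefficients of a complex power series. -/
noncomputable abbrev conjCoeff : PowerSeries ℂ →+* PowerSeries ℂ :=
  PowerSeries.map (starRingEnd ℂ)

theorem conjHom_rad (U : PowerSeries ℂ) : conjHom (rad U) = rad (conjCoeff U) := by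
  ext e
  rw [coeff_conjHom, coeff_rad, coeff_rad, mapDomain_equiv_apply, mapDomain_equiv_apply]
  simp only [Equiv.symm_swap, Equiv.swap_apply_left, Equiv.swap_apply_right, PowerSeries.coeff_map]
  by_cases h : e 0 = e 1
  · rw [if_pos h, if_pos h.symm, h]
  · rw [if_neg h, if_neg (Ne.symm h), map_zero]

theorem pderiv_rad (i : Fin 2) (U : PowerSeries ℂ) :
    pderiv ℂ i (rad U) =
      rad (PowerSeries.derivative ℂ U) * pderiv ℂ i (X 0 * X 1 : Field2) := by
  have := pderiv_subst (a := fun _ : Unit => (X 0 * X 1 : Field2))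
    (fun _ => X_mul_X_mem_orderIdeal) i U
  rw [Fintype.sum_unique] at this
  rw [rad_apply, rad_apply]
  exact this

theorem pderiv_zero_rad (U : PowerSeries ℂ) :
    pderiv ℂ 0 (rad U) = rad (PowerSeries.derivative ℂ U) * X 1 := by
  rw [pderiv_rad, Derivation.leibniz, pderiv_X_self, pderiv_X_of_ne (by decide)]
  simp

theorem pderiv_one_rad (U : PowerSeries ℂ) :
    pderiv ℂ 1 (rad U) = rad (PowerSeries.derivative ℂ U) * X 0 := by
  rw [pderiv_rad, Derivation.leibniz, pderiv_X_self, pderiv_X_of_ne (by decide)]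
  simp

/-- Along `z V(r)` the derivative of `r = z z̄` is `r (V + V̄)`, whence the last term. -/
theorem fieldDeriv_X_zero_mul_rad (V W : PowerSeries ℂ) :
    fieldDeriv (X 0 * rad V) (X 0 * rad W) = X 0 * rad (V * W +
      PowerSeries.X * (V + conjCoeff V) * PowerSeries.derivative ℂ W) := by
  rw [fieldDeriv_apply, Derivation.leibniz, Derivation.leibniz, pderiv_X_self,
    pderiv_X_of_ne (by decide), pderiv_zero_rad, pderiv_one_rad, map_mul conjHom, conjHom_rad,
    conjHom_X_zero]
  simp only [map_add, map_mul, rad_X, smul_eq_mul]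
  ring

/-- The map `z ↦ z W(r)` sends `r` to `r W W̄`, so composition preserves resonance. -/
theorem subst_pair_X_zero_mul_rad (U W : PowerSeries ℂ) :
    MvPowerSeries.subst (pair (X 0 * rad W)) (X 0 * rad U) =
      X 0 * rad (W * PowerSeries.subst (PowerSeries.X * (W * conjCoeff W)) U) := by
  have h1 : X 0 * rad W ∈ orderIdeal 1 := Ideal.mul_mem_right _ _ (X_mem_orderIdeal_one 0)
  have hs := hasSubst_pair h1
  have hR : PowerSeries.HasSubst (PowerSeries.X * (W * conjCoeff W)) :=
    PowerSeries.HasSubst.of_constantCoeff_zero' (by simp)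
  rw [MvPowerSeries.subst_mul hs, MvPowerSeries.subst_X hs, map_mul rad, rad_apply U,
    PowerSeries.subst_def, subst_comp_subst_apply hasSubst_X_mul_X.const hs,
    rad_apply (PowerSeries.subst _ U), PowerSeries.subst_comp_subst_apply hR hasSubst_X_mul_X,
    ← rad_apply, MvPowerSeries.subst_mul hs, MvPowerSeries.subst_X hs, MvPowerSeries.subst_X hs]
  simp only [pair, Matrix.cons_val_zero, Matrix.cons_val_one, map_mul, conjHom_X_zero,
    conjHom_rad, rad_X, PowerSeries.subst_def, mul_assoc]
  congr 4
  funext _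
  ring

theorem isPushforward_X_zero_mul_rad_iff {U V W : PowerSeries ℂ} :
    IsPushforward (X 0 * rad W) (X 0 * rad V) (X 0 * rad U) ↔
      V * W + PowerSeries.X * (V + conjCoeff V) * PowerSeries.derivative ℂ W =
        W * PowerSeries.subst (PowerSeries.X * (W * conjCoeff W)) U := by
  rw [isPushforward_iff, fieldDeriv_X_zero_mul_rad, subst_pair_X_zero_mul_rad]
  exact X_zero_mul_rad_injective.eq_iff

theorem hasLinearPart_X_zero_mul_rad {c : ℂ} {U : PowerSeries ℂ} :
    HasLinearPart c (X 0 * rad U) ↔ PowerSeries.constantCoeff U = c := by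
  rw [HasLinearPart, ← coeff_zero_eq_constantCoeff_apply]
  simp [coeff_X_zero_mul_rad]

end Radial

/-! ### The homological operator and resonant normal form -/

section Resonance

theorem coeff_X_mul_pderiv {σ R : Type*} [CommRing R] (i : σ) (f : MvPowerSeries σ R)
    (e : σ →₀ ℕ) : coeff e (X i * pderiv R i f) = e i * coeff e f := by
  classical
  rw [X, coeff_monomial_mul]
  split_ifs with h
  · rw [one_mul, coeff_pderiv, tsub_add_cancel_of_le h, mul_comm]
    congr 1
    rw [Finsupp.single_le_iff] at h
    rw [← Nat.cast_succ]
    congr 1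
    simp
    omega
  · rw [Finsupp.single_le_iff] at h
    rw [show e i = 0 by omega, Nat.cast_zero, zero_mul]

theorem coeff_fieldDeriv_rotation (H : Field2) (e : Fin 2 →₀ ℕ) :
    coeff e (fieldDeriv (C Complex.I * X 0) H) =
      Complex.I * ((e 0 : ℂ) - e 1) * coeff e H := by
  rw [fieldDeriv_apply, map_mul conjHom, conjHom_C, conjHom_X_zero, Complex.conj_I, mul_assoc,
    mul_assoc, map_add, coeff_C_mul, coeff_C_mul, coeff_X_mul_pderiv, coeff_X_mul_pderiv]
  ring

theorem fieldDeriv_sub_rotation_mem {F : Field2} (hF : HasLinearPart Complex.I F) {n : ℕ}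
    {H : Field2} (hH : H ∈ orderIdeal n) :
    fieldDeriv F H - fieldDeriv (C Complex.I * X 0) H ∈ orderIdeal (n + 1) := by
  rw [hasLinearPart_iff] at hF
  have hF' := conjHom_mem_orderIdeal hF
  have : fieldDeriv F H - fieldDeriv (C Complex.I * X 0) H =
      (F - C Complex.I * X 0) * pderiv ℂ 0 H +
        conjHom (F - C Complex.I * X 0) * pderiv ℂ 1 H := by
    rw [fieldDeriv_apply, fieldDeriv_apply, map_sub]
    ring
  rw [this]
  exact add_mem
    (orderIdeal_mono (by omega) (mul_mem_orderIdeal hF (pderiv_mem_orderIdeal hH 0)))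
    (orderIdeal_mono (by omega) (mul_mem_orderIdeal hF' (pderiv_mem_orderIdeal hH 1)))

/-- The defect of the equation saying that `φ` carries `F` to `G`. -/
noncomputable def defect (F G φ : Field2) : Field2 :=
  fieldDeriv F φ - MvPowerSeries.subst (pair φ) G

/-- To first order the defect depends on the state map through the homological operator. -/
theorem coeff_defect_sub {F G φ ψ : Field2} (hF : HasLinearPart Complex.I F)
    (hG : HasLinearPart Complex.I G) (hφ : φ ∈ orderIdeal 1) (hψ : ψ ∈ orderIdeal 1) {n : ℕ}
    (h : φ - ψ ∈ orderIdeal n) {e : Fin 2 →₀ ℕ} (he : e.degree < n + 1) :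
    coeff e (defect F G φ) - coeff e (defect F G ψ) =
      Complex.I * ((e 0 : ℂ) - e 1 - 1) * coeff e (φ - ψ) := by
  have hG' := subst_sub_subst_mem_orderIdeal (pair_mem_orderIdeal hφ) (pair_mem_orderIdeal hψ)
    (pair_sub_mem_orderIdeal h) (hasLinearPart_iff.1 hG)
  have key := sub_mem (fieldDeriv_sub_rotation_mem hF h) (orderIdeal_mono (by omega) hG') e he
  have hsφ := hasSubst_pair hφ
  have hsψ := hasSubst_pair hψ
  rw [MvPowerSeries.subst_sub hsφ, MvPowerSeries.subst_sub hsψ, MvPowerSeries.subst_mul hsφ,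
    MvPowerSeries.subst_mul hsψ, MvPowerSeries.subst_X hsφ, MvPowerSeries.subst_X hsψ,
    MvPowerSeries.subst_C, MvPowerSeries.subst_C, map_sub, map_sub, coeff_fieldDeriv_rotation,
    map_sub (fieldDeriv F)] at key
  simp only [map_sub, pair, Matrix.cons_val_zero, coeff_C_mul] at key
  simp only [defect, map_sub, pair]
  linear_combination key

theorem resonance_factor_ne_zero {e : Fin 2 →₀ ℕ} (he : e 0 ≠ e 1 + 1) :
    Complex.I * ((e 0 : ℂ) - e 1 - 1) ≠ 0 := by
  refine mul_ne_zero Complex.I_ne_zero fun h => he ?_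
  have : (e 0 : ℂ) = ((e 1 + 1 : ℕ) : ℂ) := by push_cast; linear_combination h
  exact_mod_cast this

/-- A near-identity map between two fields in resonant form is itself resonant. -/
theorem IsPushforward.resonant {φ : Field2} {U V : PowerSeries ℂ} (hφ : IsNearIdentity φ)
    (hV : PowerSeries.constantCoeff V = Complex.I) (hU : PowerSeries.constantCoeff U = Complex.I)
    (h : IsPushforward φ (X 0 * rad V) (X 0 * rad U)) : ∃ W, φ = X 0 * rad W := by
  classical
  -- The resonant part of `φ`. Its defect has only resonant terms and that of `φ` is zero, so off
  -- resonance the homological factor forces `φ - ψ` to vanish degree by degree.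
  let ψ : Field2 := fun e => if e 0 = e 1 + 1 then coeff e φ else 0
  have hψ : ∀ e, coeff e ψ = if e 0 = e 1 + 1 then coeff e φ else 0 := fun _ => rfl
  obtain ⟨W, hW⟩ := exists_eq_X_zero_mul_rad (F := ψ) fun e he => by rw [hψ, if_neg he]
  have hψ1 : ψ ∈ orderIdeal 1 := by
    rw [hW]; exact Ideal.mul_mem_right _ _ (X_mem_orderIdeal_one 0)
  refine ⟨W, ?_⟩
  rw [← hW]
  refine eq_of_forall_sub_mem_orderIdeal fun n => ?_
  induction n with
  | zero => exact mem_orderIdeal_zero _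
  | succ n ih =>
    intro e he
    by_cases hres : e 0 = e 1 + 1
    · rw [map_sub, hψ, if_pos hres, sub_self]
    have key := coeff_defect_sub (hasLinearPart_X_zero_mul_rad.2 hV)
      (hasLinearPart_X_zero_mul_rad.2 hU) hφ.mem_orderIdeal_one hψ1 ih he
    have h1 : defect (X 0 * rad V) (X 0 * rad U) φ = 0 := sub_eq_zero.2 (isPushforward_iff.1 h)
    have h2 : coeff e (defect (X 0 * rad V) (X 0 * rad U) ψ) = 0 := by
      rw [defect, hW, fieldDeriv_X_zero_mul_rad, subst_pair_X_zero_mul_rad, map_sub,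
        coeff_X_zero_mul_rad, coeff_X_zero_mul_rad, if_neg hres, if_neg hres, sub_zero]
    rw [h1, h2, map_zero, sub_zero] at key
    exact (mul_eq_zero.1 key.symm).resolve_left (resonance_factor_ne_zero hres)

/-- Every field with linear part `i z` is brought to a resonant form by a near-identity map. -/
theorem exists_resonant_form {F : Field2} (hF : HasLinearPart Complex.I F) :
    ∃ U : PowerSeries ℂ, PowerSeries.constantCoeff U = Complex.I ∧
      StateTransforms F (X 0 * rad U) := by
  classical
  -- A single unknown series `x` encodes both unknowns: its nonresonant coefficients define the map
  -- `φ x`, its resonant ones the target `G x`. Degrees below 2 are prescribed.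
  let nr : Field2 → Field2 := fun x e => if 2 ≤ e.degree ∧ e 0 ≠ e 1 + 1 then coeff e x else 0
  let rs : Field2 → Field2 := fun x e => if 2 ≤ e.degree ∧ e 0 = e 1 + 1 then coeff e x else 0
  have hnr : ∀ x e, coeff e (nr x) = if 2 ≤ e.degree ∧ e 0 ≠ e 1 + 1 then coeff e x else 0 :=
    fun _ _ => rfl
  have hrs : ∀ x e, coeff e (rs x) = if 2 ≤ e.degree ∧ e 0 = e 1 + 1 then coeff e x else 0 :=
    fun _ _ => rfl
  let φ : Field2 → Field2 := fun x => X 0 + nr x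
  let G : Field2 → Field2 := fun x => C Complex.I * X 0 + rs x
  have hφ : ∀ x, IsNearIdentity (φ x) := fun x => by
    rw [isNearIdentity_iff, add_sub_cancel_left]
    intro e he
    rw [hnr, if_neg (by omega)]
  have hG : ∀ x, HasLinearPart Complex.I (G x) := fun x => by
    rw [hasLinearPart_iff, add_sub_cancel_left]
    intro e he
    rw [hrs, if_neg (by omega)]
  -- The linear effect of one coefficient of `x` on the defect: the homological factor through `φ
  -- x`, or `-1` through `G x`. It never vanishes.
  let l : (Fin 2 →₀ ℕ) → ℂ := fun e =>
    if e 0 = e 1 + 1 then -1 else Complex.I * ((e 0 : ℂ) - e 1 - 1)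
  have hl : ∀ e, l e ≠ 0 := fun e => by
    simp only [l]
    split_ifs with h
    · norm_num
    · exact resonance_factor_ne_zero h
  have hdiff : ∀ n x y, x - y ∈ orderIdeal n → ∀ e : Fin 2 →₀ ℕ, e.degree < n + 1 →
      2 ≤ e.degree → coeff e (defect F (G x) (φ x)) - coeff e (defect F (G y) (φ y)) =
        l e * (coeff e x - coeff e y) := by
    intro n x y hxy e he he2
    have h1 : φ x - φ y ∈ orderIdeal n := fun e he => by
      have := hxy e he
      rw [map_sub] at this
      simp only [φ, add_sub_add_left_eq_sub, map_sub, hnr]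
      split_ifs
      · exact this
      · exact sub_zero _
    have h2 : G x - G y ∈ orderIdeal n := fun e he => by
      have := hxy e he
      rw [map_sub] at this
      simp only [G, add_sub_add_left_eq_sub, map_sub, hrs]
      split_ifs
      · exact this
      · exact sub_zero _
    have k1 := coeff_defect_sub hF (hG x) (hφ x).mem_orderIdeal_one (hφ y).mem_orderIdeal_one h1 he
    have k2 := subst_pair_sub_mem_orderIdeal (hφ y) h2 e he
    rw [MvPowerSeries.subst_sub (hasSubst_pair (hφ y).mem_orderIdeal_one)] at k2
    have k3 : coeff e (G x) - coeff e (G y) = coeff e (rs x) - coeff e (rs y) := by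
      simp [G]
    have k4 : coeff e (φ x - φ y) = coeff e (nr x) - coeff e (nr y) := by
      simp [φ]
    rw [k4] at k1
    simp only [map_sub] at k2
    rw [k3] at k2
    have k5 : coeff e (defect F (G x) (φ x)) - coeff e (defect F (G y) (φ y)) =
        Complex.I * ((e 0 : ℂ) - e 1 - 1) * (coeff e (nr x) - coeff e (nr y)) -
          (coeff e (rs x) - coeff e (rs y)) := by
      simp only [defect, map_sub] at k1 ⊢
      linear_combination k1 - k2
    rw [k5, hnr, hnr, hrs, hrs]
    by_cases hres : e 0 = e 1 + 1
    · simp [l, hres, he2]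
    · simp [l, hres, he2]
  -- A Newton step with the diagonal linearization `l`; its fixed points have zero defect in degrees
  -- at least 2.
  let Ψ : Field2 → Field2 := fun x e =>
    if 2 ≤ e.degree then coeff e x - coeff e (defect F (G x) (φ x)) / l e else 0
  have hΨ : ∀ x e, coeff e (Ψ x) =
    if 2 ≤ e.degree then coeff e x - coeff e (defect F (G x) (φ x)) / l e else 0 :=
    fun _ _ => rfl
  obtain ⟨x, hx⟩ := exists_fixedPoint_of_contracting Ψ fun n x y hxy e he => by
    rw [map_sub, hΨ, hΨ]
    split_ifs with h
    · have := hdiff n x y hxy e he h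
      have hle := hl e
      field_simp
      linear_combination -this
    · exact sub_zero _
  have hlow : defect F (G x) (φ x) ∈ orderIdeal 2 := by
    have hF1 : F ∈ orderIdeal 1 := mem_orderIdeal_one.2 hF.1
    have hG1 : G x ∈ orderIdeal 1 := mem_orderIdeal_one.2 (hG x).1
    have e1 := isNearIdentity_iff.1 (hφ x)
    have e2 : fieldDeriv F (φ x - X 0) ∈ orderIdeal 2 := by
      rw [fieldDeriv_apply]
      exact add_mem (mul_mem_orderIdeal hF1 (pderiv_mem_orderIdeal e1 0))
        (mul_mem_orderIdeal (conjHom_mem_orderIdeal hF1) (pderiv_mem_orderIdeal e1 1))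
    have e3 := subst_pair_sub_mem_orderIdeal (hφ x) hG1
    have e4 := sub_mem (hasLinearPart_iff.1 hF) (hasLinearPart_iff.1 (hG x))
    have := add_mem (sub_mem e2 e3) e4
    rw [map_sub, fieldDeriv_X_zero] at this
    rw [defect]
    convert this using 1
    ring
  have hzero : defect F (G x) (φ x) = 0 := by
    ext e
    rw [map_zero]
    rcases lt_or_ge e.degree 2 with h | h
    · exact hlow e h
    · have := hΨ x e
      rw [hx, if_pos h] at this
      have h0 : coeff e (defect F (G x) (φ x)) / l e = 0 := by linear_combination this
      exact (div_eq_zero_iff.1 h0).resolve_right (hl e)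
  obtain ⟨U, hU⟩ := exists_eq_X_zero_mul_rad (F := G x) fun e he => by
    have : coeff e (X 0 : Field2) = 0 := by
      rw [coeff_X, if_neg]
      rintro rfl
      simp at he
    simp [G, hrs, he, this]
  refine ⟨U, hasLinearPart_X_zero_mul_rad.1 (hU ▸ hG x), φ x, hφ x, ?_⟩
  rw [isPushforward_iff, ← hU]
  exact sub_eq_zero.1 hzero

end Resonance

end HopfNF

namespace HopfNF

open PowerSeries

/-! ### The amplitude equation in one variable -/

section OneVariable

variable {K : Type*} [Field K]

theorem hasSubst_X_mul (g : K⟦X⟧) : PowerSeries.HasSubst (X * g) :=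
  PowerSeries.HasSubst.of_constantCoeff_zero' (by simp)

theorem mem_orderIdeal_iff_X_pow_dvd {n : ℕ} {f : K⟦X⟧} : f ∈ orderIdeal n ↔ X ^ n ∣ f := by
  rw [X_pow_dvd_iff, mem_orderIdeal]
  constructor
  · intro h m hm
    exact h (Finsupp.single () m) (by simpa using hm)
  · intro h d hd
    rw [← PowerSeries.coeff_def (n := d ()) rfl]
    refine h _ ?_
    rwa [Finsupp.degree_eq_sum, Fintype.sum_unique] at hd

theorem X_pow_dvd_subst_sub_subst {n : ℕ} {R R' : K⟦X⟧} (hR : constantCoeff R = 0)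
    (hR' : constantCoeff R' = 0) (h : X ^ n ∣ R - R') (f : K⟦X⟧) :
    X ^ n ∣ f.subst R - f.subst R' := by
  have hs := PowerSeries.HasSubst.of_constantCoeff_zero' hR
  have hs' := PowerSeries.HasSubst.of_constantCoeff_zero' hR'
  -- Removing the constant term, which substitution fixes, compensates the loss of one degree in the
  -- general estimate.
  have hf : f - C (constantCoeff f) ∈ orderIdeal 1 := by
    rw [mem_orderIdeal_iff_X_pow_dvd, pow_one, X_dvd_iff]
    simp
  have := subst_sub_subst_mem_orderIdeal (a := fun _ : Unit => R) (b := fun _ => R')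
    (fun _ => mem_orderIdeal_one.2 hR) (fun _ => mem_orderIdeal_one.2 hR')
    (fun _ => mem_orderIdeal_iff_X_pow_dvd.2 h) hf
  rw [Nat.add_sub_cancel, mem_orderIdeal_iff_X_pow_dvd] at this
  change X ^ n ∣ PowerSeries.subst R (f - C (constantCoeff f)) -
    PowerSeries.subst R' (f - C (constantCoeff f)) at this
  rw [PowerSeries.subst_sub hs, PowerSeries.subst_sub hs', PowerSeries.subst_C,
    PowerSeries.subst_C, sub_sub_sub_cancel_right] at this
  exact this

theorem constantCoeff_subst_X_mul (g f : K⟦X⟧) :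
    constantCoeff (f.subst (X * g)) = constantCoeff f := by
  have h := X_pow_dvd_subst_sub_subst (n := 1) (R := X * g) (R' := X) (by simp) (by simp)
    (by rw [pow_one]; exact dvd_sub (dvd_mul_right _ _) dvd_rfl) f
  rw [X_subst, pow_one, X_dvd_iff, map_sub, sub_eq_zero] at h
  exact h

theorem exists_subst_eq {g : K⟦X⟧} (hg : constantCoeff g = 1) (Q : K⟦X⟧) :
    ∃ S : K⟦X⟧, S.subst (X * g) = Q := by
  have h1 : IsUnit (coeff 1 (X * g)) := by
    rw [show (1 : ℕ) = 0 + 1 from rfl, coeff_succ_X_mul, coeff_zero_eq_constantCoeff_apply, hg]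
    exact isUnit_one
  refine ⟨Q.subst ((X * g).substInvOfIsUnit h1), ?_⟩
  rw [PowerSeries.subst_comp_subst_apply (PowerSeries.HasSubst.substInvOfIsUnit _ h1)
    (hasSubst_X_mul g), subst_substInvOfIsUnit_left _ (by simp), X_subst]

/-- Up to the leading order `n` of `f`, the other factor acts only through its constant term; this
linearizes the equations below. -/
theorem coeff_mul_of_X_pow_dvd {n k : ℕ} {f : K⟦X⟧} (hf : X ^ n ∣ f) (hk : k ≤ n) (u : K⟦X⟧) :
    coeff k (f * u) = coeff k f * constantCoeff u := by
  obtain ⟨s, rfl⟩ := hf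
  rw [mul_assoc, coeff_X_pow_mul', coeff_X_pow_mul']
  split_ifs with h
  · simp [show k = n by omega]
  · simp

theorem coeff_add_X_mul_derivative (c : K) (f : K⟦X⟧) (n : ℕ) :
    coeff n (f + C c * (X * derivative K f)) = (1 + c * n) * coeff n f := by
  cases n with
  | zero => simp
  | succ n =>
    rw [map_add, coeff_C_mul, coeff_succ_X_mul, coeff_derivative]
    push_cast
    ring

theorem exists_pow_sub_pow_eq (a b : K⟦X⟧) (ha : constantCoeff a = 1) (hb : constantCoeff b = 1)
    (m : ℕ) : ∃ c, a ^ m - b ^ m = (a - b) * c ∧ constantCoeff c = m := by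
  induction m with
  | zero => exact ⟨0, by simp, by simp⟩
  | succ m ih =>
    obtain ⟨c, hc, hc'⟩ := ih
    refine ⟨a ^ m + c * b, ?_, by simp [ha, hb, hc', add_comm]⟩
    linear_combination b * hc

theorem coeff_pow_sub_pow {n k m : ℕ} {a b : K⟦X⟧} (ha : constantCoeff a = 1)
    (hb : constantCoeff b = 1) (h : X ^ n ∣ a - b) (hk : k ≤ n) :
    coeff k (a ^ m - b ^ m) = m * coeff k (a - b) := by
  obtain ⟨c, hc, hc'⟩ := exists_pow_sub_pow_eq a b ha hb m
  rw [hc, coeff_mul_of_X_pow_dvd h hk, hc', mul_comm]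

theorem exponent_eq_of_X_pow_mul_eq {M N : ℕ} {a b : K⟦X⟧} (ha : constantCoeff a ≠ 0)
    (hb : constantCoeff b ≠ 0) (h : X ^ N * a = X ^ M * b) : M = N := by
  have aux : ∀ {M N : ℕ} {a b : K⟦X⟧}, constantCoeff a ≠ 0 → X ^ N * a = X ^ M * b → M ≤ N := by
    intro M N a b ha h
    by_contra hlt
    have hd : X ^ (N + 1) ∣ X ^ N * a := by
      rw [h]
      exact Dvd.dvd.mul_right (pow_dvd_pow _ (by omega)) _
    have := X_pow_dvd_iff.1 hd N (Nat.lt_succ_self _)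
    rw [coeff_X_pow_mul', if_pos le_rfl, Nat.sub_self] at this
    exact ha (by simpa using this)
  exact le_antisymm (aux ha h) (aux hb h.symm)

/-- Rigidity of the amplitude equation: the leading coefficient and the residue term are
invariant, and the conjugating map is the identity to the corresponding order. -/
theorem amplitude_rigidity [CharZero K] {N : ℕ} (hN : 1 ≤ N) {g s t : K⟦X⟧} {a b : K}
    (hg : constantCoeff g = 1) (ha : a ≠ 0)
    (h : (g + X * derivative K g) * (C a + X ^ N * s) = g ^ (N + 1) * (C b + X ^ N * t)) :
    a = b ∧ constantCoeff s = constantCoeff t ∧ X ^ N ∣ g - 1 := by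
  have hN0 : N ≠ 0 := by omega
  have hab : a = b := by
    have := congrArg constantCoeff h
    simpa [hg, hN0] using this
  subst hab
  have hf : ∀ n, coeff n (g + X * derivative K g) = (1 + n) * coeff n g := fun n => by
    simpa using coeff_add_X_mul_derivative (1 : K) g n
  -- If `g = 1 + O(X^k)`, the two sides contribute `a (1 + k)` and `a (N + 1)` times the `k`-th
  -- coefficient of `g - 1`; the difference `a (k - N)` is invertible for `k < N` and disappears at
  -- `k = N`.
  have key : ∀ k, k ≤ N → X ^ k ∣ g - 1 →
      a * (k - N) * coeff k (g - 1) + coeff k (X ^ N * s) = coeff k (X ^ N * t) := by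
    intro k hk hd
    have e1 : X ^ k ∣ g + X * derivative K g - 1 := by
      rw [X_pow_dvd_iff] at hd ⊢
      intro m hm
      have := hd m hm
      rw [map_sub] at this ⊢
      rw [hf]
      rcases Nat.eq_zero_or_pos m with rfl | hm0
      · simpa using this
      · rw [coeff_one, if_neg hm0.ne', sub_zero] at this ⊢
        rw [this, mul_zero]
    have e2 : X ^ k ∣ g ^ (N + 1) - 1 := by
      have := sub_dvd_pow_sub_pow g 1 (N + 1)
      rw [one_pow] at this
      exact hd.trans this
    have c1 := coeff_mul_of_X_pow_dvd e1 le_rfl (C a + X ^ N * s)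
    have c2 := coeff_mul_of_X_pow_dvd e2 le_rfl (C a + X ^ N * t)
    have c3 := coeff_pow_sub_pow (m := N + 1) hg (by simp) hd le_rfl
    have c4 := hf k
    have c5 := congrArg (coeff k) h
    rw [one_pow] at c3
    have c6 : (k : K) * coeff k (1 : K⟦X⟧) = 0 := by
      rw [coeff_one]
      split_ifs with hk0 <;> simp [hk0]
    simp only [sub_mul, one_mul, map_sub, map_add, constantCoeff_C, map_mul, map_pow,
      constantCoeff_X, zero_pow hN0, zero_mul, add_zero] at c1 c2 c3 c4 c5 ⊢
    push_cast at c3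
    linear_combination c5 - c1 + c2 + a * c3 - a * c4 - a * c6
  have hdvd : ∀ k, k ≤ N → X ^ k ∣ g - 1 := by
    intro k
    induction k with
    | zero => intro _; simp
    | succ k ih =>
      intro hk
      have hd := ih (by omega)
      have := key k (by omega) hd
      rw [coeff_X_pow_mul', coeff_X_pow_mul', if_neg (by omega), if_neg (by omega),
        add_zero] at this
      have hne : (k : K) - N ≠ 0 := by
        rw [sub_ne_zero]
        exact_mod_cast (by omega : k ≠ N)
      have h0 := (mul_eq_zero.1 this).resolve_left (mul_ne_zero ha hne)
      rw [X_pow_dvd_iff] at hd ⊢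
      intro m hm
      rcases Nat.lt_succ_iff_lt_or_eq.1 hm with hm | rfl
      · exact hd m hm
      · exact h0
  refine ⟨rfl, ?_, hdvd N le_rfl⟩
  have := key N le_rfl (hdvd N le_rfl)
  simpa [coeff_X_pow_mul'] using this

/-- Normalization of the amplitude equation. -/
theorem exists_amplitude_normalization [CharZero K] {N : ℕ} (hN : 1 ≤ N) (u : K⟦X⟧)
    (hu : constantCoeff u ≠ 0) :
    ∃ (y : K⟦X⟧) (c : K), constantCoeff y = 1 ∧
      (y + C 2 * (X * derivative K y)) * u =
        y ^ (2 * N + 1) * (C (constantCoeff u) + C c * X ^ N * y ^ (2 * N)) := by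
  classical
  set A := constantCoeff u
  have hN0 : N ≠ 0 := by omega
  -- The `N`-th coefficient of `y` has no linear effect at order `N`, so it is set to 0 and its slot
  -- in `x` holds the unknown `c` instead.
  let y : K⟦X⟧ → K⟦X⟧ := fun x =>
    PowerSeries.mk fun k => if k = 0 then 1 else if k = N then 0 else coeff k x
  have hy : ∀ x k, coeff k (y x) = if k = 0 then 1 else if k = N then 0 else coeff k x :=
    fun x k => coeff_mk _ _
  have hy0 : ∀ x, constantCoeff (y x) = 1 := fun x => by
    rw [← coeff_zero_eq_constantCoeff_apply, hy, if_pos rfl]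
  let E : K⟦X⟧ → K⟦X⟧ := fun x => (y x + C 2 * (X * derivative K (y x))) * u -
    y x ^ (2 * N + 1) * (C A + C (coeff N x) * X ^ N * y x ^ (2 * N))
  let l : ℕ → K := fun k => if k = N then -1 else 2 * A * (k - N)
  have hl : ∀ k, l k ≠ 0 := fun k => by
    simp only [l]
    split_ifs with h
    · exact neg_ne_zero.2 one_ne_zero
    · refine mul_ne_zero (mul_ne_zero two_ne_zero hu) (sub_ne_zero.2 ?_)
      exact_mod_cast h
  have hdiff : ∀ n x x', X ^ n ∣ x - x' → ∀ k, k ≤ n → k ≠ 0 →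
      coeff k (E x) - coeff k (E x') = l k * (coeff k x - coeff k x') := by
    intro n x x' hx k hk hk0
    have hxc : ∀ m < n, coeff m x = coeff m x' := fun m hm => by
      have := X_pow_dvd_iff.1 hx m hm
      rwa [map_sub, sub_eq_zero] at this
    have hd : X ^ n ∣ y x - y x' := by
      rw [X_pow_dvd_iff]
      intro m hm
      rw [map_sub, hy, hy, hxc m hm, sub_self]
    have hd2 : X ^ n ∣ (y x - y x') + C 2 * (X * derivative K (y x - y x')) := by
      rw [X_pow_dvd_iff] at hd ⊢
      intro m hm
      rw [coeff_add_X_mul_derivative, hd m hm, mul_zero]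
    have c1 := coeff_mul_of_X_pow_dvd hd2 hk u
    rw [coeff_add_X_mul_derivative] at c1
    have c2 := coeff_pow_sub_pow (m := 2 * N + 1) (hy0 x) (hy0 x') hd hk
    have c3 : coeff k (C (coeff N x - coeff N x') * X ^ N * y x ^ (4 * N + 1)) =
        if k = N then coeff N x - coeff N x' else 0 := by
      by_cases hn : n ≤ N
      · rw [coeff_mul_of_X_pow_dvd (n := N) (dvd_mul_left _ _) (hk.trans hn), coeff_C_mul,
          coeff_X_pow, map_pow, hy0, one_pow, mul_one]
        split_ifs <;> simp
      · rw [hxc N (by omega), sub_self]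
        simp
    have c4 : coeff k (C (coeff N x') * X ^ N * (y x ^ (4 * N + 1) - y x' ^ (4 * N + 1))) = 0 := by
      have : X ^ (N + n) ∣
          C (coeff N x') * X ^ N * (y x ^ (4 * N + 1) - y x' ^ (4 * N + 1)) := by
        rw [pow_add]
        exact mul_dvd_mul (dvd_mul_left _ _) (hd.trans (sub_dvd_pow_sub_pow _ _ _))
      exact X_pow_dvd_iff.1 this k (by omega)
    have hE : E x - E x' =
        ((y x - y x') + C 2 * (X * derivative K (y x - y x'))) * u
          - C A * (y x ^ (2 * N + 1) - y x' ^ (2 * N + 1))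
          - C (coeff N x - coeff N x') * X ^ N * y x ^ (4 * N + 1)
          - C (coeff N x') * X ^ N * (y x ^ (4 * N + 1) - y x' ^ (4 * N + 1)) := by
      simp only [E, map_sub]
      ring
    rw [← map_sub (coeff k), hE, map_sub, map_sub, map_sub, c1, c3, c4, coeff_C_mul, c2, map_sub,
      hy, hy]
    simp only [l, hk0, if_false]
    by_cases hkN : k = N
    · simp [hkN]
    · simp only [hkN, if_false]
      push_cast
      ring
  let Ψ : K⟦X⟧ → K⟦X⟧ := fun x =>
    PowerSeries.mk fun k => if k = 0 then 0 else coeff k x - coeff k (E x) / l k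
  have hΨ : ∀ x k, coeff k (Ψ x) = if k = 0 then 0 else coeff k x - coeff k (E x) / l k :=
    fun x k => coeff_mk _ _
  obtain ⟨x, hx⟩ := exists_fixedPoint_of_contracting (σ := Unit) Ψ fun n x x' hxx' => by
    refine mem_orderIdeal_iff_X_pow_dvd.2 (X_pow_dvd_iff.2 fun k hk => ?_)
    rw [map_sub, hΨ, hΨ]
    split_ifs with h
    · exact sub_zero _
    · have := hdiff n x x' (mem_orderIdeal_iff_X_pow_dvd.1 hxx') k (by omega) h
      have hlk := hl k
      field_simp
      linear_combination -this
  refine ⟨y x, coeff N x, hy0 x, sub_eq_zero.1 ?_⟩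
  change E x = 0
  ext k
  rw [map_zero]
  by_cases hk : k = 0
  · subst hk
    simp [E, hy0, hN0, A]
  · have := hΨ x k
    rw [hx, if_neg hk] at this
    have h0 : coeff k (E x) / l k = 0 := by linear_combination this
    exact (div_eq_zero_iff.1 h0).resolve_right (hl k)

end OneVariable

end HopfNF

namespace HopfNF

open PowerSeries

/-! ### Polar fields: scaling, rotation and the invariants of conjugacy -/

section Polar

/-- The complexification of a real power series. -/
noncomputable abbrev toComplex : ℝ⟦X⟧ →+* ℂ⟦X⟧ := PowerSeries.map Complex.ofRealHom

theorem polarField_eq (P Q : ℝ⟦X⟧) :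
    polarField P Q = MvPowerSeries.X 0 * rad (toComplex P + C Complex.I * toComplex Q) := by
  rw [polarField, radial_eq_rad, radial_eq_rad, map_add, map_mul, rad_C]

theorem constantCoeff_powerSeries_map {A B : Type*} [CommRing A] [CommRing B] (h : A →+* B) (f : A⟦X⟧) :
    constantCoeff (PowerSeries.map h f) = h (constantCoeff f) := by
  rw [← coeff_zero_eq_constantCoeff_apply, PowerSeries.coeff_map,
    coeff_zero_eq_constantCoeff_apply]

theorem conjCoeff_toComplex (P : ℝ⟦X⟧) : conjCoeff (toComplex P) = toComplex P := by
  ext n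
  simp

theorem conjCoeff_subst {R : ℂ⟦X⟧} (hR : constantCoeff R = 0) (f : ℂ⟦X⟧) :
    conjCoeff (f.subst R) = (conjCoeff f).subst (conjCoeff R) :=
  PowerSeries.map_subst (PowerSeries.HasSubst.of_constantCoeff_zero' hR) f

theorem toComplex_subst {R : ℝ⟦X⟧} (hR : constantCoeff R = 0) (f : ℝ⟦X⟧) :
    toComplex (f.subst R) = (toComplex f).subst (toComplex R) :=
  PowerSeries.map_subst (PowerSeries.HasSubst.of_constantCoeff_zero' hR) f

theorem map_derivative {A B : Type*} [CommRing A] [CommRing B] (h : A →+* B) (f : A⟦X⟧) :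
    PowerSeries.map h (derivative A f) = derivative B (PowerSeries.map h f) := by
  ext n
  simp [coeff_derivative]

theorem exists_toComplex_add (U : ℂ⟦X⟧) :
    ∃ P Q : ℝ⟦X⟧, U = toComplex P + C Complex.I * toComplex Q := by
  refine ⟨PowerSeries.mk fun n => (coeff n U).re, PowerSeries.mk fun n => (coeff n U).im, ?_⟩
  ext n
  rw [map_add, coeff_C_mul, PowerSeries.coeff_map, PowerSeries.coeff_map, coeff_mk, coeff_mk,
    mul_comm]
  exact (Complex.re_add_im _).symm

theorem constantCoeff_toComplex_add (P Q : ℝ⟦X⟧) :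
    constantCoeff (toComplex P + C Complex.I * toComplex Q) =
      ((constantCoeff P : ℝ) : ℂ) + Complex.I * ((constantCoeff Q : ℝ) : ℂ) := by
  rw [map_add, map_mul, constantCoeff_C, constantCoeff_powerSeries_map, constantCoeff_powerSeries_map]
  rfl

theorem radial_mul_polarField (T P Q : ℝ⟦X⟧) :
    radial T * polarField P Q = polarField (T * P) (T * Q) := by
  rw [polarField_eq, polarField_eq, radial_eq_rad]
  simp only [map_mul, map_add]
  ring

/-- A map `z ↦ z W(z z̄)` acts on fields in polar form through `W`. -/
theorem stateTransforms_polarField {P Q P' Q' : ℝ⟦X⟧} (W : ℂ⟦X⟧) (hW : constantCoeff W = 1)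
    (h : (toComplex P + C Complex.I * toComplex Q) * W +
        C 2 * (X * toComplex P * derivative ℂ W) =
      W * PowerSeries.subst (X * (W * conjCoeff W))
        (toComplex P' + C Complex.I * toComplex Q')) :
    StateTransforms (polarField P Q) (polarField P' Q') := by
  refine ⟨MvPowerSeries.X 0 * rad W, hasLinearPart_X_zero_mul_rad.2 hW, ?_⟩
  rw [polarField_eq, polarField_eq, isPushforward_X_zero_mul_rad_iff, ← h]
  simp only [map_add, map_mul, conjCoeff_toComplex, PowerSeries.map_C, Complex.conj_I, map_neg]
  rw [show (C 2 : ℂ⟦X⟧) = 2 from map_ofNat _ 2]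
  ring

/-- For real `W = y` one has `W W̄ = y²`: the amplitude is rescaled and the phase merely
reparametrized. -/
theorem stateTransforms_scaling {P Q P' Q' : ℝ⟦X⟧} (y : ℝ⟦X⟧) (hy : constantCoeff y = 1)
    (hP : (y + C 2 * (X * derivative ℝ y)) * P = y * P'.subst (X * (y * y)))
    (hQ : Q'.subst (X * (y * y)) = Q) :
    StateTransforms (polarField P Q) (polarField P' Q') := by
  refine stateTransforms_polarField (toComplex y) (by simp [constantCoeff_powerSeries_map, hy]) ?_
  have hs : PowerSeries.HasSubst (X * (toComplex y * toComplex y)) := hasSubst_X_mul _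
  have h1 := congrArg toComplex hP
  have h2 := congrArg toComplex hQ
  rw [map_mul, map_mul, toComplex_subst (by simp)] at h1
  rw [toComplex_subst (by simp)] at h2
  simp only [map_add, map_mul, map_derivative, PowerSeries.map_C, PowerSeries.map_X] at h1 h2
  rw [conjCoeff_toComplex, PowerSeries.subst_add hs, PowerSeries.subst_mul hs,
    PowerSeries.subst_C, h2]
  change _ = toComplex y * (_ + C Complex.I * _)
  have h3 : (C (Complex.ofRealHom 2) : ℂ⟦X⟧) = C 2 := by simp
  rw [h3] at h1
  linear_combination h1

/-- A rotation depending on the amplitude changes the phase equation by a multiple of the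
amplitude equation. -/
theorem stateTransforms_phase (P Q k : ℝ⟦X⟧) :
    StateTransforms (polarField P Q) (polarField P (Q + C 2 * (X * P * k))) := by
  -- `κ` is the antiderivative of `k`, to be used as rotation angle: `W = exp(iκ)` satisfies `W' = i
  -- k W` and has modulus 1, so `r` is preserved.
  obtain ⟨κ, hκ, hκ0⟩ : ∃ κ : ℂ⟦X⟧, derivative ℂ κ = toComplex k ∧ constantCoeff κ = 0 := by
    refine ⟨PowerSeries.mk fun n => coeff (n - 1) (toComplex k) / n, ?_, ?_⟩
    · ext n
      rw [coeff_derivative, coeff_mk, Nat.add_sub_cancel]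
      have : ((n : ℂ) + 1) ≠ 0 := by exact_mod_cast n.succ_ne_zero
      push_cast
      field_simp
    · rw [← coeff_zero_eq_constantCoeff_apply, coeff_mk]
      simp
  have hX : constantCoeff (C Complex.I * κ) = 0 := by simp [hκ0]
  have hs := PowerSeries.HasSubst.of_constantCoeff_zero' hX
  set W : ℂ⟦X⟧ := (PowerSeries.exp ℂ).subst (C Complex.I * κ) with hWdef
  have hW' : derivative ℂ W = C Complex.I * toComplex k * W := by
    rw [hWdef, derivative_subst hs, derivative_exp, Derivation.leibniz, derivative_C, hκ]
    simp only [smul_eq_mul, mul_zero, add_zero]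
    ring
  have hW0 : constantCoeff W = 1 := by
    have h : constantCoeff (PowerSeries.subst (C Complex.I * κ) (PowerSeries.exp ℂ - C 1)) = 0 :=
      PowerSeries.constantCoeff_subst_eq_zero hX _ (by simp)
    rw [PowerSeries.subst_sub hs, PowerSeries.subst_C] at h
    rw [map_sub, sub_eq_zero] at h
    rw [hWdef, h]
    exact constantCoeff_C 1
  have hWc' : derivative ℂ (conjCoeff W) = -(C Complex.I * toComplex k * conjCoeff W) := by
    rw [← map_derivative, hW']
    simp only [map_mul, conjCoeff_toComplex, PowerSeries.map_C, Complex.conj_I, map_neg]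
    ring
  have hWW : W * conjCoeff W = 1 := by
    refine derivative.ext ?_ ?_
    · rw [Derivation.leibniz, hW', hWc', derivative_one]
      simp only [smul_eq_mul]
      ring
    · simp [constantCoeff_powerSeries_map, hW0]
  refine stateTransforms_polarField W hW0 ?_
  rw [hWW, mul_one, X_subst, hW']
  have h3 : (C (Complex.ofRealHom 2) : ℂ⟦X⟧) = C 2 := by simp
  simp only [map_add, map_mul, PowerSeries.map_C, PowerSeries.map_X, h3]
  ring

/-- A near-identity conjugacy of two fields in polar form yields a reparametrization
`r ↦ r g(r)` of `r = ρ²` relating the amplitude equations and, up to a multiple of the amplitude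
equation, the phase equations. -/
theorem StateTransforms.exists_reparametrization {P Q P' Q' : ℝ⟦X⟧}
    (hP : constantCoeff P = 0) (hQ : constantCoeff Q = 1) (hP' : constantCoeff P' = 0)
    (hQ' : constantCoeff Q' = 1) (h : StateTransforms (polarField P Q) (polarField P' Q')) :
    ∃ g k : ℂ⟦X⟧, constantCoeff g = 1 ∧
      (g + X * derivative ℂ g) * toComplex P = g * (toComplex P').subst (X * g) ∧
      toComplex Q + X * toComplex P * k = (toComplex Q').subst (X * g) := by
  obtain ⟨φ, hφ, h⟩ := h
  rw [polarField_eq, polarField_eq] at h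
  have hV : constantCoeff (toComplex P + C Complex.I * toComplex Q) = Complex.I := by
    rw [constantCoeff_toComplex_add, hP, hQ]; simp
  have hU : constantCoeff (toComplex P' + C Complex.I * toComplex Q') = Complex.I := by
    rw [constantCoeff_toComplex_add, hP', hQ']; simp
  obtain ⟨W, rfl⟩ := h.resonant hφ hV hU
  have hW0 : constantCoeff W = 1 := hasLinearPart_X_zero_mul_rad.1 hφ
  rw [isPushforward_X_zero_mul_rad_iff] at h
  obtain ⟨g, hg⟩ : ∃ g, g = W * conjCoeff W := ⟨_, rfl⟩
  have hg0 : constantCoeff g = 1 := by simp [hg, constantCoeff_powerSeries_map, hW0]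
  have hgc : conjCoeff g = g := by
    rw [hg, map_mul, mul_comm]
    congr 1
    ext n
    simp
  have hs : PowerSeries.HasSubst (X * g) := hasSubst_X_mul g
  rw [← hg] at h
  have hc := congrArg conjCoeff h
  rw [map_mul, conjCoeff_subst (by simp)] at hc
  simp only [map_add, map_mul, conjCoeff_toComplex, PowerSeries.map_C, Complex.conj_I,
    PowerSeries.map_X, hgc, map_derivative, map_neg, neg_neg] at h hc
  rw [PowerSeries.subst_add hs, PowerSeries.subst_mul hs, PowerSeries.subst_C] at h
  rw [show -C Complex.I = (C (-Complex.I) : ℂ⟦X⟧) from (map_neg _ _).symm,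
    PowerSeries.subst_add hs, PowerSeries.subst_mul hs, PowerSeries.subst_C] at hc
  change _ = W * (_ + (C Complex.I : ℂ⟦X⟧) * _) at h
  change _ = conjCoeff W * (_ + (C (-Complex.I) : ℂ⟦X⟧) * _) at hc
  rw [map_neg] at hc
  have hg' : derivative ℂ g = W * derivative ℂ (conjCoeff W) + conjCoeff W * derivative ℂ W := by
    rw [hg, Derivation.leibniz, smul_eq_mul, smul_eq_mul]
  have h2 : (2 : ℂ⟦X⟧) ≠ 0 := fun h0 => by
    have := congrArg constantCoeff h0
    rw [map_ofNat, map_zero] at this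
    exact two_ne_zero this
  have hI : (C Complex.I : ℂ⟦X⟧) * C Complex.I = -1 := by
    rw [← map_mul, Complex.I_mul_I, map_neg, map_one]
  -- This `k` is twice the derivative of the argument of `W`. Adding `W̄` times the equation and `W`
  -- times its conjugate isolates the amplitude; subtracting isolates the phase.
  refine ⟨g, -C Complex.I * (conjCoeff W * derivative ℂ W - W * derivative ℂ (conjCoeff W)) * g⁻¹,
    hg0, ?_, ?_⟩
  · refine mul_left_cancel₀ h2 ?_
    rw [hg', hg]
    rw [hg] at h hc
    linear_combination conjCoeff W * h + W * hc
  · have hgi : g * g⁻¹ = 1 := PowerSeries.mul_inv_cancel _ (by rw [hg0]; exact one_ne_zero)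
    have hgne : g ≠ 0 := fun h0 => by simp [h0] at hgi
    refine mul_left_cancel₀ (mul_ne_zero h2 hgne) ?_
    set D := conjCoeff W * derivative ℂ W - W * derivative ℂ (conjCoeff W) with hD
    set q := (toComplex Q').subst (X * g)
    set i : ℂ⟦X⟧ := C Complex.I
    linear_combination -i * (conjCoeff W * h - W * hc) - 2 * i * X * toComplex P * D * hgi +
      (2 * g * (toComplex Q - q)) * hI - 2 * i * i * (toComplex Q - q) * hg +
      2 * i * X * toComplex P * hD

end Polar

end HopfNF

namespace HopfNF

open PowerSeries

/-! ### Existence of the three normal forms -/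

section NormalForms

theorem monomial_eq_C_mul_X_pow {R : Type*} [CommRing R] (n : ℕ) (a : R) :
    PowerSeries.monomial n a = C a * X ^ n := by
  ext m
  rw [coeff_monomial, coeff_C_mul_X_pow]

theorem amplitude_eq {R : Type*} [CommRing R] (N : ℕ) (A A' : R) :
    PowerSeries.monomial N A + PowerSeries.monomial (2 * N) A' =
      X ^ N * (C A + X ^ N * C A') := by
  rw [monomial_eq_C_mul_X_pow, monomial_eq_C_mul_X_pow]
  ring

theorem coeff_one_add_sum_monomial (N : ℕ) (B : ℕ → ℝ) (i : ℕ) :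
    coeff i (1 + ∑ j ∈ Finset.Icc 1 N, PowerSeries.monomial j (B j)) =
      if i = 0 then 1 else if i ≤ N then B i else 0 := by
  classical
  rw [map_add, map_sum, coeff_one]
  simp only [coeff_monomial]
  rw [Finset.sum_ite_eq]
  rcases Nat.eq_zero_or_pos i with rfl | hi
  · simp
  · simp [hi.ne', Nat.succ_le_of_lt hi]

theorem constantCoeff_amplitude {N : ℕ} (hN : 1 ≤ N) (A A' : ℝ) :
    constantCoeff (PowerSeries.monomial N A + PowerSeries.monomial (2 * N) A') = 0 := by
  rw [amplitude_eq]
  simp [show N ≠ 0 by omega]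

theorem constantCoeff_phase (N : ℕ) (B : ℕ → ℝ) :
    constantCoeff (1 + ∑ i ∈ Finset.Icc 1 N, PowerSeries.monomial i (B i)) = 1 := by
  rw [← coeff_zero_eq_constantCoeff_apply, coeff_one_add_sum_monomial, if_pos rfl]

theorem toComplex_amplitude (N : ℕ) (A A' : ℝ) :
    toComplex (PowerSeries.monomial N A + PowerSeries.monomial (2 * N) A') =
      X ^ N * (C (A : ℂ) + X ^ N * C (A' : ℂ)) := by
  rw [amplitude_eq]
  simp

theorem subst_amplitude {K : Type*} [Field K] (g : K⟦X⟧) (N : ℕ) (A A' : K) :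
    PowerSeries.subst (X * g) (X ^ N * (C A + X ^ N * C A')) =
      (X * g) ^ N * (C A + (X * g) ^ N * C A') := by
  have hs := hasSubst_X_mul g
  rw [PowerSeries.subst_mul hs, PowerSeries.subst_add hs, PowerSeries.subst_mul hs,
    PowerSeries.subst_pow hs, PowerSeries.subst_X hs, PowerSeries.subst_C, PowerSeries.subst_C]
  rfl

/-- A generalized Hopf singularity is brought to the polar form with amplitude equation of finite
order. -/
theorem IsGeneralizedHopf.exists_polar_form {F : Field2} (hF : IsGeneralizedHopf F) :
    ∃ (N : ℕ) (u Q : ℝ⟦X⟧), 1 ≤ N ∧ constantCoeff u ≠ 0 ∧ constantCoeff Q = 1 ∧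
      StateTransforms F (polarField (X ^ N * u) Q) := by
  obtain ⟨U, hU, hFU⟩ := exists_resonant_form hF.1
  obtain ⟨P, Q, rfl⟩ := exists_toComplex_add U
  rw [← polarField_eq] at hFU
  rw [constantCoeff_toComplex_add] at hU
  have hP0 : constantCoeff P = 0 := by simpa using congrArg Complex.re hU
  have hQ1 : constantCoeff Q = 1 := by simpa using congrArg Complex.im hU
  -- Formal nontriviality of the amplitude is needed only here; it makes the order of `P` finite.
  have hP : P ≠ 0 := by
    rintro rfl
    exact hF.2 ⟨Q, hFU⟩
  refine ⟨P.order.toNat, P.divXPowOrder, Q, ?_, ?_, hQ1, ?_⟩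
  · by_contra h
    have h0 : P.order.toNat = 0 := by omega
    have h1 : P.divXPowOrder = P := by
      have := X_pow_order_mul_divXPowOrder (f := P)
      rwa [h0, pow_zero, one_mul] at this
    refine hP (constantCoeff_divXPowOrder_eq_zero_iff.1 ?_)
    rw [h1, hP0]
  · exact fun h => hP (constantCoeff_divXPowOrder_eq_zero_iff.1 h)
  · rwa [X_pow_order_mul_divXPowOrder]

/-- Normalization of the amplitude equation of a field in polar form, up to a factor. -/
theorem exists_normal_amplitude {N : ℕ} (hN : 1 ≤ N) {u : ℝ⟦X⟧} (hu : constantCoeff u ≠ 0) :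
    ∃ (A' : ℝ) (y : ℝ⟦X⟧), constantCoeff y = 1 ∧ ∀ T T' Q Q' : ℝ⟦X⟧,
      T'.subst (X * (y * y)) = T → Q'.subst (X * (y * y)) = Q →
      StateTransforms (polarField (T * (X ^ N * u)) Q) (polarField (T' *
        (PowerSeries.monomial N (constantCoeff u) + PowerSeries.monomial (2 * N) A')) Q') := by
  obtain ⟨y, A', hy, h⟩ := exists_amplitude_normalization hN u hu
  refine ⟨A', y, hy, fun T T' Q Q' hT hQ => stateTransforms_scaling y hy ?_ hQ⟩
  rw [PowerSeries.subst_mul (hasSubst_X_mul _), hT, amplitude_eq, subst_amplitude]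
  linear_combination T * X ^ N * h

theorem exists_stateForm {N : ℕ} (hN : 1 ≤ N) {u Q : ℝ⟦X⟧} (hu : constantCoeff u ≠ 0)
    (hQ : constantCoeff Q = 1) :
    ∃ (A A' : ℝ) (B : ℕ → ℝ), A ≠ 0 ∧
      StateTransforms (polarField (X ^ N * u) Q) (stateForm N A A' B) := by
  obtain ⟨A', y, hy, h⟩ := exists_normal_amplitude hN hu
  obtain ⟨Q', hQ'⟩ := exists_subst_eq (g := y * y) (by simp [hy]) Q
  have hQ1 : constantCoeff Q' = 1 := by rw [← constantCoeff_subst_X_mul (y * y), hQ', hQ]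
  have h1 := h 1 1 Q Q' (by rw [← map_one C, PowerSeries.subst_C]; rfl) hQ'
  rw [one_mul, one_mul] at h1
  set A := constantCoeff u
  refine ⟨A, A', fun i => coeff i Q', hu, h1.trans ?_⟩
  -- The phase terms beyond `N` are divisible by `X ^ (N + 1)`, hence by `X` times the amplitude,
  -- and an amplitude-dependent rotation removes them.
  have hd : X ^ (N + 1) ∣
      (1 + ∑ i ∈ Finset.Icc 1 N, PowerSeries.monomial i (coeff i Q')) - Q' := by
    rw [X_pow_dvd_iff]
    intro m hm
    rw [map_sub, coeff_one_add_sum_monomial]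
    split_ifs with h0 h2
    · rw [h0, coeff_zero_eq_constantCoeff_apply, hQ1, sub_self]
    · exact sub_self _
    · omega
  obtain ⟨t, ht⟩ := hd
  have hv : constantCoeff (C A + X ^ N * C A') ≠ 0 := by
    simpa [show N ≠ 0 by omega] using hu
  have key := stateTransforms_phase
    (PowerSeries.monomial N A + PowerSeries.monomial (2 * N) A') Q'
    (C 2⁻¹ * t * (C A + X ^ N * C A')⁻¹)
  have e : Q' + C 2 * (X * (PowerSeries.monomial N A + PowerSeries.monomial (2 * N) A') *
      (C 2⁻¹ * t * (C A + X ^ N * C A')⁻¹)) =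
      1 + ∑ i ∈ Finset.Icc 1 N, PowerSeries.monomial i (coeff i Q') := by
    have h2 : (C 2 : ℝ⟦X⟧) * C 2⁻¹ = 1 := by rw [← map_mul]; norm_num
    have hi := PowerSeries.mul_inv_cancel _ hv
    rw [amplitude_eq]
    linear_combination X ^ (N + 1) * t * ((C A + X ^ N * C A') * (C A + X ^ N * C A')⁻¹) * h2 +
      X ^ (N + 1) * t * hi - ht
  rw [e] at key
  exact key

/-- Dividing by `Q` would leave phase 1 and amplitude `X ^ N * (u / Q)`, and it is this quotient
that gets normalized. As the state map must precede the time rescaling, the factor `Q` is carried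
through the map and becomes `S`. -/
theorem exists_orbital_polar_form {N : ℕ} (hN : 1 ≤ N) {u Q : ℝ⟦X⟧} (hu : constantCoeff u ≠ 0)
    (hQ : constantCoeff Q = 1) :
    ∃ (A A' : ℝ) (S : ℝ⟦X⟧), A ≠ 0 ∧ constantCoeff S = 1 ∧
      StateTransforms (polarField (X ^ N * u) Q) (polarField (S *
        (PowerSeries.monomial N A + PowerSeries.monomial (2 * N) A')) S) := by
  have hQi : Q * Q⁻¹ = 1 := PowerSeries.mul_inv_cancel _ (by rw [hQ]; exact one_ne_zero)
  have hu' : constantCoeff (u * Q⁻¹) ≠ 0 := by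
    rw [map_mul, PowerSeries.constantCoeff_inv, hQ, inv_one, mul_one]
    exact hu
  obtain ⟨A', y, hy, h⟩ := exists_normal_amplitude hN hu'
  obtain ⟨S, hS⟩ := exists_subst_eq (g := y * y) (by simp [hy]) Q
  refine ⟨_, A', S, hu', by rw [← constantCoeff_subst_X_mul (y * y), hS, hQ], ?_⟩
  have h1 := h Q S Q S hS hS
  rwa [show Q * (X ^ N * (u * Q⁻¹)) = X ^ N * u by linear_combination X ^ N * u * hQi] at h1

theorem orbitallyTransforms_of_stateTransforms {F : Field2} {S P Q : ℝ⟦X⟧}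
    (hS : constantCoeff S = 1) (h : StateTransforms F (polarField (S * P) (S * Q))) :
    OrbitallyTransforms F (polarField P Q) := by
  have hi : S⁻¹ * S = 1 := PowerSeries.inv_mul_cancel _ (by rw [hS]; exact one_ne_zero)
  refine ⟨S⁻¹, _, ?_, h, ?_⟩
  · rw [PowerSeries.constantCoeff_inv, hS, inv_one]
  · rw [radial_mul_polarField, ← mul_assoc, ← mul_assoc, hi, one_mul, one_mul]

theorem OrbitallyTransforms.exists_stateTransforms {F : Field2} {P Q : ℝ⟦X⟧}
    (h : OrbitallyTransforms F (polarField P Q)) :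
    ∃ S : ℝ⟦X⟧, constantCoeff S = 1 ∧ StateTransforms F (polarField (S * P) (S * Q)) := by
  obtain ⟨T, H, hT, hFH, hG⟩ := h
  have hi : T⁻¹ * T = 1 := PowerSeries.inv_mul_cancel _ (by rw [hT]; exact one_ne_zero)
  refine ⟨T⁻¹, by rw [PowerSeries.constantCoeff_inv, hT, inv_one], ?_⟩
  have hr : radial T⁻¹ * radial T = 1 := by
    rw [radial_eq_rad, radial_eq_rad, ← map_mul, ← map_mul, hi, map_one, map_one]
  rw [← radial_mul_polarField, hG, ← mul_assoc, hr, one_mul]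
  exact hFH

theorem exists_orbitalForm₂ {N : ℕ} (hN : 1 ≤ N) {A : ℝ} (A' : ℝ) (hA : A ≠ 0) {S : ℝ⟦X⟧}
    (hS : constantCoeff S = 1) :
    ∃ B : ℝ, OrbitallyTransforms (polarField (S *
      (PowerSeries.monomial N A + PowerSeries.monomial (2 * N) A')) S) (orbitalForm₂ N A B) := by
  obtain ⟨c, rfl⟩ : ∃ c, A' = A * c := ⟨A' / A, by field_simp⟩
  obtain ⟨n, rfl⟩ : ∃ n, N = n + 1 := ⟨N - 1, by omega⟩
  have hd : constantCoeff (1 + C c * X ^ (n + 1)) = 1 := by simp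
  have hi := PowerSeries.mul_inv_cancel (1 + C c * X ^ (n + 1)) (by rw [hd]; exact one_ne_zero)
  -- Dividing time by `S (1 + c X^N)` leaves amplitude `A X^N` and phase `1 / (1 + c X^N)`, whose
  -- expansion starts `1 - c X^N`.
  refine ⟨-c, orbitallyTransforms_of_stateTransforms (S := S * (1 + C c * X ^ (n + 1)))
    (by rw [map_mul, hS, hd, one_mul]) ?_⟩
  -- The rotation is chosen so that the phase `S` becomes `S (1 - c² X^(2N)) = S (1 + c X^N) (1 - c
  -- X^N)`. Its factor `X ^ n` requires `N = n + 1 ≥ 1`.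
  have key := stateTransforms_phase (S * (PowerSeries.monomial (n + 1) A +
    PowerSeries.monomial (2 * (n + 1)) (A * c))) S
    (-C (c ^ 2 * (2 * A)⁻¹) * X ^ n * (1 + C c * X ^ (n + 1))⁻¹)
  have hC : (C 2 : ℝ⟦X⟧) * C A * C (c ^ 2 * (2 * A)⁻¹) = C c ^ 2 := by
    rw [← map_mul, ← map_mul, ← map_pow]
    congr 1
    field_simp
  convert key using 2
  · rw [amplitude_eq, monomial_eq_C_mul_X_pow, map_mul]
    ring
  · rw [amplitude_eq, monomial_eq_C_mul_X_pow, map_mul, map_neg]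
    linear_combination (S * X ^ (2 * (n + 1)) * C 2 * C A * C (c ^ 2 * (2 * A)⁻¹)) * hi +
      S * X ^ (2 * (n + 1)) * hC

end NormalForms

/-! ### Uniqueness of the normal forms -/

section Uniqueness

theorem amplitude_exponent_eq {K : Type*} [Field K] {M N : ℕ} {g u v : K⟦X⟧}
    (hg : constantCoeff g = 1) (hu : constantCoeff u ≠ 0) (hv : constantCoeff v ≠ 0)
    (h : (g + X * derivative K g) * (X ^ N * u) = g * ((X * g) ^ M * v)) :
    M = N ∧ (g + X * derivative K g) * u = g ^ (N + 1) * v := by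
  have h' : X ^ N * ((g + X * derivative K g) * u) = X ^ M * (g ^ (M + 1) * v) := by
    linear_combination h
  have hMN : M = N := exponent_eq_of_X_pow_mul_eq (by simpa [hg] using hu)
    (by simpa [hg] using hv) h'
  subst hMN
  exact ⟨rfl, mul_left_cancel₀ (pow_ne_zero _ X_ne_zero) h'⟩

theorem stateForm_unique {N M : ℕ} (hN : 1 ≤ N) (hM : 1 ≤ M) {A A' a a' : ℝ} {B b : ℕ → ℝ}
    (hA : A ≠ 0) (ha : a ≠ 0)
    (h : StateTransforms (stateForm N A A' B) (stateForm M a a' b)) :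
    M = N ∧ a = A ∧ a' = A' ∧ ∀ i ∈ Finset.Icc 1 N, b i = B i := by
  obtain ⟨g, k, hg, h1, h2⟩ := h.exists_reparametrization (constantCoeff_amplitude hN A A')
    (constantCoeff_phase N B) (constantCoeff_amplitude hM a a') (constantCoeff_phase M b)
  have hN0 : N ≠ 0 := by omega
  have hM0 : M ≠ 0 := by omega
  rw [toComplex_amplitude, toComplex_amplitude, subst_amplitude] at h1
  obtain ⟨rfl, h1⟩ := amplitude_exponent_eq hg (by simpa [hN0] using hA)
    (by simpa [hM0] using ha) h1
  rw [mul_pow, mul_assoc (X ^ M) (g ^ M)] at h1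
  obtain ⟨e1, e2, e3⟩ := amplitude_rigidity hN hg (Complex.ofReal_ne_zero.2 hA) h1
  refine ⟨rfl, (Complex.ofReal_injective e1).symm, ?_, ?_⟩
  · simp only [constantCoeff_C, map_mul, map_pow, hg, one_pow, one_mul] at e2
    exact (Complex.ofReal_injective e2).symm
  · intro i hi
    rw [Finset.mem_Icc] at hi
    -- Rigidity gives `g = 1 + O(X^M)`, so reparametrization leaves the phase unchanged through
    -- degree `M`; the correction by the amplitude also starts at `X ^ (M + 1)`.
    have hR : X ^ (M + 1) ∣ X * g - X := by
      rw [pow_succ', show X * g - X = X * (g - 1) by ring]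
      exact mul_dvd_mul_left _ e3
    have c1 := X_pow_dvd_iff.1 (X_pow_dvd_subst_sub_subst (by simp) (by simp) hR
      (toComplex (1 + ∑ i ∈ Finset.Icc 1 M, PowerSeries.monomial i (b i)))) i (by omega)
    rw [X_subst, ← h2, toComplex_amplitude] at c1
    have c2 : coeff i (X * (X ^ M * (C (A : ℂ) + X ^ M * C (A' : ℂ))) * k) = 0 := by
      refine X_pow_dvd_iff.1 ?_ i (Nat.lt_succ_of_le hi.2)
      rw [Nat.succ_eq_add_one, pow_succ', mul_assoc, mul_assoc]
      exact mul_dvd_mul_left _ (dvd_mul_right _ _)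
    rw [map_sub, map_add, c2, add_zero, PowerSeries.coeff_map, PowerSeries.coeff_map,
      coeff_one_add_sum_monomial, coeff_one_add_sum_monomial, if_neg (by omega), if_pos hi.2,
      if_neg (by omega), if_pos hi.2, sub_eq_zero] at c1
    exact (Complex.ofReal_injective c1).symm

/-- Each orbital form is a state form up to an unknown time factor. Cross-multiplying the amplitude
and phase equations eliminates both factors. -/
theorem OrbitallyTransforms.exists_reparametrization {F : Field2} {P Q P' Q' : ℝ⟦X⟧}
    (hP : constantCoeff P = 0) (hQ : constantCoeff Q = 1) (hP' : constantCoeff P' = 0)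
    (hQ' : constantCoeff Q' = 1) (h : OrbitallyTransforms F (polarField P Q))
    (h' : OrbitallyTransforms F (polarField P' Q')) :
    ∃ g k : ℂ⟦X⟧, constantCoeff g = 1 ∧
      (g + X * derivative ℂ g) * (toComplex P * (toComplex Q').subst (X * g)) =
        g * ((toComplex P').subst (X * g) * (toComplex Q + X * toComplex P * k)) := by
  obtain ⟨S, hS, hF⟩ := h.exists_stateTransforms
  obtain ⟨S', hS', hF'⟩ := h'.exists_stateTransforms
  obtain ⟨g, k, hg, h1, h2⟩ := (hF.symm.trans hF').exists_reparametrization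
    (by rw [map_mul, hP, mul_zero]) (by rw [map_mul, hS, hQ, one_mul])
    (by rw [map_mul, hP', mul_zero]) (by rw [map_mul, hS', hQ', one_mul])
  have hs := hasSubst_X_mul g
  simp only [map_mul, PowerSeries.subst_mul hs] at h1 h2
  have hS0 : toComplex S ≠ 0 := fun h0 => by
    have := congrArg constantCoeff h0
    rw [constantCoeff_powerSeries_map, hS] at this
    simp at this
  refine ⟨g, k, hg, mul_left_cancel₀ hS0 ?_⟩
  linear_combination (toComplex Q').subst (X * g) * h1 -
    g * (toComplex P').subst (X * g) * h2

theorem orbitalForm₁_unique {F : Field2} {N M : ℕ} (hN : 1 ≤ N) (hM : 1 ≤ M) {A A' a a' : ℝ}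
    (hA : A ≠ 0) (ha : a ≠ 0) (h : OrbitallyTransforms F (orbitalForm₁ N A A'))
    (h' : OrbitallyTransforms F (orbitalForm₁ M a a')) :
    M = N ∧ a = A ∧ a' = A' := by
  obtain ⟨g, k, hg, h1⟩ := OrbitallyTransforms.exists_reparametrization
    (constantCoeff_amplitude hN A A') (map_one _) (constantCoeff_amplitude hM a a') (map_one _) h h'
  have hN0 : N ≠ 0 := by omega
  have hM0 : M ≠ 0 := by omega
  have hone : (1 : ℂ⟦X⟧).subst (X * g) = 1 := by rw [← map_one C, PowerSeries.subst_C]; rfl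
  rw [toComplex_amplitude, toComplex_amplitude, subst_amplitude, map_one, hone, mul_one,
    mul_assoc ((X * g) ^ M)] at h1
  obtain ⟨rfl, h1⟩ := amplitude_exponent_eq hg (by simpa [hN0] using hA)
    (by simpa [hM0] using ha) h1
  -- The rotation term carries `X ^ (M + 1)`, so it is absorbed in `X * t` and leaves the residue
  -- alone.
  obtain ⟨t, ht⟩ : ∃ t, (C (a : ℂ) + (X * g) ^ M * C (a' : ℂ)) *
      (1 + X * (X ^ M * (C (A : ℂ) + X ^ M * C (A' : ℂ))) * k) = C (a : ℂ) +
        X ^ M * (g ^ M * C (a' : ℂ) + X * t) :=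
    ⟨(C (a : ℂ) + (X * g) ^ M * C (a' : ℂ)) * (C (A : ℂ) + X ^ M * C (A' : ℂ)) * k, by ring⟩
  rw [ht] at h1
  obtain ⟨e1, e2, -⟩ := amplitude_rigidity hN hg (Complex.ofReal_ne_zero.2 hA) h1
  refine ⟨rfl, (Complex.ofReal_injective e1).symm, ?_⟩
  simp only [constantCoeff_C, map_add, map_mul, map_pow, hg, one_pow, one_mul, constantCoeff_X,
    zero_mul, add_zero] at e2
  exact (Complex.ofReal_injective e2).symm

theorem orbitalForm₂_unique {F : Field2} {N M : ℕ} (hN : 1 ≤ N) (hM : 1 ≤ M) {A B a b : ℝ}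
    (hA : A ≠ 0) (ha : a ≠ 0) (h : OrbitallyTransforms F (orbitalForm₂ N A B))
    (h' : OrbitallyTransforms F (orbitalForm₂ M a b)) :
    M = N ∧ a = A ∧ b = B := by
  have hN0 : N ≠ 0 := by omega
  have hM0 : M ≠ 0 := by omega
  rw [orbitalForm₂, monomial_eq_C_mul_X_pow, monomial_eq_C_mul_X_pow] at h h'
  obtain ⟨g, k, hg, h1⟩ := OrbitallyTransforms.exists_reparametrization
    (by simp [hN0]) (by simp [hN0]) (by simp [hM0]) (by simp [hM0]) h h'
  have hs := hasSubst_X_mul g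
  have hsC : ∀ c : ℂ, (C c).subst (X * g) = C c := fun c => PowerSeries.subst_C c
  have hone : (1 : ℂ⟦X⟧).subst (X * g) = 1 := by rw [← map_one C, hsC]
  simp only [map_add, map_mul, map_pow, map_one, PowerSeries.map_C, PowerSeries.map_X,
    PowerSeries.subst_add hs, PowerSeries.subst_mul hs, PowerSeries.subst_pow hs,
    PowerSeries.subst_X hs, hsC, hone, Complex.ofRealHom_eq_coe] at h1
  have h2 : (g + X * derivative ℂ g) *
      (X ^ N * (C (A : ℂ) * (1 + C (b : ℂ) * (X * g) ^ M))) = g * ((X * g) ^ M *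
        (C (a : ℂ) * (1 + C (B : ℂ) * X ^ N + X * (C (A : ℂ) * X ^ N) * k))) := by
    linear_combination h1
  obtain ⟨rfl, h2⟩ := amplitude_exponent_eq hg (by simpa [hM0] using hA)
    (by simpa [hN0] using ha) h2
  -- After cross-multiplication the phase coefficients play the part of the residue: rigidity yields
  -- `a = A` and `A b = a B`.
  have h3 : (g + X * derivative ℂ g) *
      (C (A : ℂ) + X ^ M * (C (A : ℂ) * C (b : ℂ) * g ^ M)) = g ^ (M + 1) *
        (C (a : ℂ) + X ^ M * (C (a : ℂ) * (C (B : ℂ) + X * C (A : ℂ) * k))) := by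
    linear_combination h2
  obtain ⟨e1, e2, -⟩ := amplitude_rigidity hN hg (Complex.ofReal_ne_zero.2 hA) h3
  have haA : a = A := (Complex.ofReal_injective e1).symm
  refine ⟨rfl, haA, ?_⟩
  simp only [constantCoeff_C, map_add, map_mul, map_pow, hg, one_pow, mul_one, constantCoeff_X,
    zero_mul, add_zero, haA] at e2
  exact Complex.ofReal_injective (mul_left_cancel₀ (Complex.ofReal_ne_zero.2 hA) e2)

end Uniqueness

theorem StateTransforms.trans_orbital {F G H : Field2} (h : StateTransforms F G)
    (h' : OrbitallyTransforms G H) : OrbitallyTransforms F H := by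
  obtain ⟨T, K, hT, hGK, hH⟩ := h'
  exact ⟨T, K, hT, h.trans hGK, hH⟩

end HopfNF

theorem mainTheorem8 (F : HopfNF.Field2) (hF : HopfNF.IsGeneralizedHopf F) :
    ∃ N₀ : ℕ, 1 ≤ N₀ ∧
      (∃ (A A' : ℝ) (B : ℕ → ℝ), A ≠ 0 ∧
        HopfNF.StateTransforms F (HopfNF.stateForm N₀ A A' B) ∧
        ∀ (M : ℕ) (a a' : ℝ) (b : ℕ → ℝ), 1 ≤ M → a ≠ 0 →
          HopfNF.StateTransforms F (HopfNF.stateForm M a a' b) →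
          M = N₀ ∧ a = A ∧ a' = A' ∧ ∀ i ∈ Finset.Icc 1 N₀, b i = B i) ∧
      (∃ A A' : ℝ, A ≠ 0 ∧
        HopfNF.OrbitallyTransforms F (HopfNF.orbitalForm₁ N₀ A A') ∧
        ∀ (M : ℕ) (a a' : ℝ), 1 ≤ M → a ≠ 0 →
          HopfNF.OrbitallyTransforms F (HopfNF.orbitalForm₁ M a a') →
          M = N₀ ∧ a = A ∧ a' = A') ∧
      (∃ A B : ℝ, A ≠ 0 ∧
        HopfNF.OrbitallyTransforms F (HopfNF.orbitalForm₂ N₀ A B) ∧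
        ∀ (M : ℕ) (a b : ℝ), 1 ≤ M → a ≠ 0 →
          HopfNF.OrbitallyTransforms F (HopfNF.orbitalForm₂ M a b) →
          M = N₀ ∧ a = A ∧ b = B) := by
  obtain ⟨N, u, Q, hN, hu, hQ, hFP⟩ := hF.exists_polar_form
  obtain ⟨A₁, A₁', B₁, hA₁, h₁⟩ := HopfNF.exists_stateForm hN hu hQ
  obtain ⟨A, A', S, hA, hS, h⟩ := HopfNF.exists_orbital_polar_form hN hu hQ
  obtain ⟨B, hB⟩ := HopfNF.exists_orbitalForm₂ hN A' hA hS
  have hF₁ := hFP.trans h₁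
  have hF₂ : HopfNF.OrbitallyTransforms F (HopfNF.orbitalForm₁ N A A') :=
    HopfNF.orbitallyTransforms_of_stateTransforms hS (by rw [mul_one]; exact hFP.trans h)
  have hF₃ := (hFP.trans h).trans_orbital hB
  refine ⟨N, hN, ⟨A₁, A₁', B₁, hA₁, hF₁, fun M a a' b hM ha hM' => ?_⟩,
    ⟨A, A', hA, hF₂, fun M a a' hM ha hM' => ?_⟩, ⟨A, B, hA, hF₃, fun M a b hM ha hM' => ?_⟩⟩
  · exact HopfNF.stateForm_unique hN hM hA₁ ha (hF₁.symm.trans hM')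
  · exact HopfNF.orbitalForm₁_unique hN hM hA ha hF₂ hM'
  · exact HopfNF.orbitalForm₂_unique hN hM hA ha hF₃ hM'
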